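/- **Setting.** Fix an integer $q\ge 2$ and let $\omega=e^{2\pi i/q}$, $Z=\sum_j\omega^j|j\rangle\langle j|$, $X=\sum_{j\in\mathbb Z_q}|j\rangle\langle j+1|$. For $\mathbf a,\mathbf b\in\mathbb Z_q^n$ the Pauli operator $P=\bigotimes_i X^{a_i}Z^{b_i}$ has $\mathrm{wt}_X(P)=\mathrm{wt}(\mathbf a)$ and $\mathrm{wt}_Z(P)=\mathrm{wt}(\mathbf b)$ (Hamming weights). Let $V_q(r)=\sum_{w=0}^{r}\binom nw(q-1)^w$, $\rho=2V_q(d_Z-1)$, and $\mathrm{Ent}_q(x)=-x\log_q x-(1-x)\log_q(1-x)+x\log_q(q-1)$. Orthonormal states $|0_L\rangle,\dots,|(M-1)_L\rangle$ of $n$ qudits are a quantum code with bit-flip distance $d_X$ and phase-flip distance $d_Z$ if for every Pauli $P$ with $\mathrm{wt}_X(P)\le d_X-1$ and $\mathrm{wt}_Z(P)\le d_Z-1$ there is $c_P\in\mathbb C$ with $\langle i_L|P|j_L\rangle=c_P\delta_{ij}$ for all $i,j$. Let $A$ be the real matrix whose columns are indexed by words $\mathbf c\in\mathbb Z_q^n$,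 whose first row is all ones, and whose other rows are $\mathrm{Re}\langle\mathbf c|P|\mathbf c\rangle$ and $\mathrm{Im}\langle\mathbf c|P|\mathbf c\rangle$ for the diagonal Paulis $P=Z^{z_1}\otimes\cdots\otimes Z^{z_n}$ with $1\le \mathrm{wt}(\mathbf z)\le d_Z-1$. For a set $S$ of columns, $A_S$ is the corresponding submatrix. *Dines elimination* of the first row $(a_{1k})_k$ of a system keeps the columns $k$ with $a_{1k}=0$ and replaces the others by one column for each pair $(i,j)$ with $a_{1i}>0>a_{1j}$, with entries $a_{1i}a_{rj}-a_{1j}a_{ri}$. After all rows are eliminated, setting all remaining variables to $1$ and substituting back gives a nonnegative solution of the original system. The system $A_S\mathbf y=\mathbf b$ is *unobstructed* if in the augmented homogeneous system $[A_S\,|-\mathbf b]$ no row other than the first, and in the systems that arise from it by successive eliminations no row at all, has all entries nonzero and of the same sign (a row without entries counts as such a row). *The construction.* For a code $C\subseteq\mathbb Z_q^n$, take a set $D\subseteq C$ of columns and a nonzero real $\mathbf x$ supported on $D$ with $A\mathbf x=0$; write $\mathbf x=\mathbf x^+-\mathbf x^-$ (positive and negative parts). Put $\mathbf y_0=\mathbf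 x^-$ and, for successive column sets $S_1,S_2,\dots$, let $\mathbf y_k$ be the solution of $A_{S_k}\mathbf y_k=A\mathbf y_{k-1}$ given by Dines elimination. The logical states are $\sum_{\mathbf c}\sqrt{y_{\mathbf c}/\sum y}\,|\mathbf c\rangle$ for $\mathbf y=\mathbf x^+,\mathbf x^-,\mathbf y_1,\mathbf y_2,\dots$. *Alg. 2* (one call): given $\mathbf b$ and the ordered list of unused columns of $C$, let $S$ consist of the first $\rho$ of them; as long as $A_S\mathbf y=\mathbf b$ is obstructed, add the next unused column to $S$; return the Dines solution, and count the columns of $S$ as used. The call fails if the columns are exhausted. **Lemma.** (1) Let $d_X,d_Z\ge1$, let $C\subseteq\mathbb Z_q^n$ have all pairwise Hamming distances of distinct codewords at least $d_X$, let $D\subseteq C$ and $\mathbf x$ be as in the construction, and let $S_1,\dots,S_{M-2}\subseteq C\setminus D$ be pairwise disjoint with at least $\rho$ elements each. If at every step of the recursion the system $A_{S_k}\mathbf y_k=A\mathbf y_{k-1}$ is unobstructed, then the $M$ logical states are a quantum code with bit-flip distance $d_X$ and phase-flip distance $d_Z$, and they are real combinations of basis states over pairwise disjoint subsets of $C$.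 (2) Let $0<R\le1$, $0\le\delta\le1-\frac1q$, $0<r<R-2\,\mathrm{Ent}_q(\delta)$, and let $d_Z=d_Z(n)$ satisfy $1\le d_Z\le\delta n+1$ for all large $n$. Draw $\lceil q^{Rn}\rceil$ words of length $n$ with all letters independent and uniform, and let $C$ be the code of the distinct words drawn, in a list without repetitions. With probability tending to $1$ as $n\to\infty$ there are a set $D\subseteq C$ of $\rho$ columns and a nonzero $\mathbf x$ supported on $D$ with $A\mathbf x=0$ such that, for some $M\ge q^{rn}$, $M-2$ successive calls of Alg. 2 on the columns in $C\setminus D$, in their listed order, all succeed, and the $M$ resulting logical states are (for every $d_X\ge1$ that is a lower bound for the distances of distinct codewords of $C$) a quantum code with bit-flip distance $d_X$ and phase-flip distance $d_Z$, as in (1). In particular the code has constant rate, at least $r$. (3) If $R>0$, $0\le\delta\le 1-\frac1q$ and $2R+\mathrm{Ent}_q(\delta)<1$, then for the random code $C$ of (2) the distinct codewords have pairwise distances at least $\lceil\delta n\rceil$ with probability tending to $1$ as $n\to\infty$, so that the bit-flip distance in (2) is then linear in $n$. -/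

import Mathlib

open Filter Topology

namespace DinesCode

/-! ### Words, qudits and Pauli operators -/

/-- Words of length `n` over the alphabet `{0, …, q - 1}`. They label the computational basis of
`n` qudits. -/
abbrev Word (q n : ℕ) : Type := Fin n → ZMod q

/-- The volume of a `q`-ary Hamming ball of radius `r` in length `n`. -/
def ballVolume (q n r : ℕ) : ℕ :=
  ∑ w ∈ Finset.range (r + 1), n.choose w * (q - 1) ^ w

/-- The number `2 V_q(d_Z - 1)` of columns with which every step starts. -/
def blockSize (q n dZ : ℕ) : ℕ := 2 * ballVolume q n (dZ - 1)

/-- All codewords of `C` are at pairwise Hamming distance at least `d`. -/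
def HasMinDist {q n : ℕ} (C : Finset (Word q n)) (d : ℕ) : Prop :=
  ∀ c ∈ C, ∀ c' ∈ C, c ≠ c' → d ≤ hammingDist c c'

/-- The `q`-ary entropy function, with logarithms to base `q`. -/
noncomputable def entropy (q : ℕ) (p : ℝ) : ℝ := Real.qaryEntropy q p / Real.log q

section Pauli

variable {q : ℕ} [NeZero q] {n : ℕ}

/-- `X = ∑ |j⟩⟨j + 1|`. -/
def pauliX (q : ℕ) : Matrix (ZMod q) (ZMod q) ℂ :=
  Matrix.of fun i j => if j = i + 1 then 1 else 0

/-- `Z = ∑ ω ^ j |j⟩⟨j|` with `ω = exp (2 π i / q)`. -/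
noncomputable def pauliZ (q : ℕ) : Matrix (ZMod q) (ZMod q) ℂ :=
  Matrix.diagonal fun j => Complex.exp (2 * Real.pi * Complex.I / q) ^ j.val

/-- The Pauli operator `X^{a₁} Z^{b₁} ⊗ ⋯ ⊗ X^{aₙ} Z^{bₙ}` in the computational basis. -/
noncomputable def pauli (a b : Word q n) : Matrix (Word q n) (Word q n) ℂ :=
  Matrix.of fun s t => ∏ i, (pauliX q ^ (a i).val * pauliZ q ^ (b i).val) (s i) (t i)

/-- The Knill-Laflamme conditions `⟨i|P|j⟩ = c_P δ_{ij}` for an orthonormal family of logical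
states and all Pauli operators `P` with `wt_X(P) ≤ d_X - 1` and `wt_Z(P) ≤ d_Z - 1`. -/
def KnillLaflamme (dX dZ : ℕ) {M : ℕ} (ψ : Fin M → Word q n → ℂ) : Prop :=
  (∀ i j, star (ψ i) ⬝ᵥ ψ j = if i = j then 1 else 0) ∧
  ∀ a b : Word q n, hammingNorm a ≤ dX - 1 → hammingNorm b ≤ dZ - 1 →
    ∃ cP : ℂ, ∀ i j, star (ψ i) ⬝ᵥ (pauli a b).mulVec (ψ j) = if i = j then cP else 0

/-- The family `ψ` is a quantum code with bit-flip distance `dX` and phase-flip distance `dZ`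
whose logical states are `∑_{c ∈ C_j} α_c |c⟩`, with real coefficients, for pairwise disjoint
subsets `C_j` of the classical code `C`. -/
def IsQuantumCodeFrom (C : Finset (Word q n)) (dX dZ : ℕ) {M : ℕ}
    (ψ : Fin M → Word q n → ℂ) : Prop :=
  (∃ (S : Fin M → Finset (Word q n)) (α : Fin M → Word q n → ℝ),
    (∀ j, S j ⊆ C) ∧ (∀ i j, i ≠ j → Disjoint (S i) (S j)) ∧
    ∀ j c, ψ j c = if c ∈ S j then (α j c : ℂ) else 0) ∧
  KnillLaflamme dX dZ ψ

/-- The normalized logical state `∑_c √(x_c / ∑ x) |c⟩` of a nonnegative vector `x`. -/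
noncomputable def logicalState (x : Word q n → ℝ) : Word q n → ℂ :=
  fun c => (Real.sqrt (x c / ∑ c', x c') : ℂ)

/-- The logical states of a list of nonnegative vectors. -/
noncomputable def logicalStates (xs : List (Word q n → ℝ)) :
    Fin xs.length → Word q n → ℂ :=
  fun i => logicalState (xs.get i)

/-! ### The constraint matrix -/

/-- Indices of the rows other than the first: a diagonal Pauli operator of weight between `1` and
`d_Z - 1`, and the choice of real part (`false`) or imaginary part (`true`). -/
abbrev ErrorRow (q n dZ : ℕ) : Type :=
  {z : Word q n // 1 ≤ hammingNorm z ∧ hammingNorm z ≤ dZ - 1} × Bool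

/-- The number of rows other than the first, `2 V_q(d_Z - 1) - 2`. -/
noncomputable def numErrorRows (q n dZ : ℕ) [NeZero q] : ℕ := Fintype.card (ErrorRow q n dZ)

/-- The matrix `A` with columns indexed by all words; a classical code selects some of its
columns. The first row is all ones, the others are `Re ⟨c|P|c⟩` and `Im ⟨c|P|c⟩`. -/
noncomputable def constraintMatrix (q n dZ : ℕ) [NeZero q] :
    Matrix (Fin (numErrorRows q n dZ + 1)) (Word q n) ℝ :=
  Matrix.of (Fin.cons (fun _ => 1) fun s c =>
    let e := (Fintype.equivFin (ErrorRow q n dZ)).symm s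
    if e.2 then (pauli 0 e.1.1 c c).im else (pauli 0 e.1.1 c c).re)

end Pauli

/-! ### Dines' elimination -/

/-- All entries of the row are nonzero and of the same sign. -/
def OneSigned {κ : Type} (a : κ → ℝ) : Prop := (∀ k, 0 < a k) ∨ (∀ k, a k < 0)

/-- The columns after eliminating the row `a`: the columns in which `a` vanishes, and the pairs of
a column with a positive entry and a column with a negative entry. -/
abbrev DinesCols {κ : Type} (a : κ → ℝ) : Type :=
  {k // a k = 0} ⊕ ({i // 0 < a i} × {j // a j < 0})

/-- Elimination of the first row; the pair `(i, j)` gets the entries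
`a_{1i} a_{rj} - a_{1j} a_{ri}`. -/
def dinesStep {κ : Type} {r : ℕ} (A : Matrix (Fin (r + 1)) κ ℝ) :
    Matrix (Fin r) (DinesCols (A 0)) ℝ :=
  Matrix.of fun s c => match c with
    | Sum.inl k => A s.succ k
    | Sum.inr (i, j) => A 0 i * A s.succ j - A 0 j * A s.succ i

/-- No matrix that occurs in the elimination has a row of nonzero entries of the same sign. -/
def NoOneSignedRow : (r : ℕ) → (κ : Type) → Matrix (Fin r) κ ℝ → Prop
  | 0, _, _ => True
  | r + 1, _, A => (∀ s, ¬ OneSigned (A s)) ∧ NoOneSignedRow r _ (dinesStep A)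

open Classical in
/-- The nonnegative solution of `A x = 0` computed by the elimination: all variables of the last
system, which has no equations, are set to `1`, and the others are found by back substitution. -/
noncomputable def dinesSolve :
    (r : ℕ) → (κ : Type) → [Fintype κ] → Matrix (Fin r) κ ℝ → κ → ℝ
  | 0, _, _, _ => fun _ => 1
  | r + 1, _, _, A => fun k =>
      let y := dinesSolve r (DinesCols (A 0)) (dinesStep A)
      if h0 : A 0 k = 0 then y (Sum.inl ⟨k, h0⟩)
      else if hp : 0 < A 0 k then ∑ j : {j // A 0 j < 0}, -A 0 j * y (Sum.inr (⟨k, hp⟩, j))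
      else if hn : A 0 k < 0 then ∑ i : {i // 0 < A 0 i}, A 0 i * y (Sum.inr (i, ⟨k, hn⟩))
      else 0

/-! ### The recursive construction -/

section Recursion

variable {q : ℕ} [NeZero q] {n : ℕ} (dZ : ℕ)

/-- The homogeneous system `[A_S | -b]` in the unknowns `(x, t)` that belongs to `A_S x = b`. -/
noncomputable def augmented (b : Fin (numErrorRows q n dZ + 1) → ℝ) (S : Finset (Word q n)) :
    Matrix (Fin (numErrorRows q n dZ + 1)) (Option S) ℝ :=
  Matrix.of fun s o => match o with
    | none => -b s
    | some c => constraintMatrix q n dZ s c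

/-- In the augmented system no row other than the first has all entries nonzero and of the same
sign, nor has any row of the systems that arise from it by elimination. -/
def Unobstructed (b : Fin (numErrorRows q n dZ + 1) → ℝ) (S : Finset (Word q n)) : Prop :=
  (∀ s, s ≠ 0 → ¬ OneSigned (augmented dZ b S s)) ∧
  NoOneSignedRow _ _ (dinesStep (augmented dZ b S))

/-- The solution of `A_S x = b` that Dines' method returns, extended by zero. -/
noncomputable def dinesPoint (b : Fin (numErrorRows q n dZ + 1) → ℝ) (S : Finset (Word q n)) :
    Word q n → ℝ := fun c =>
  if h : c ∈ S then
    dinesSolve _ _ (augmented dZ b S) (some ⟨c, h⟩) / dinesSolve _ _ (augmented dZ b S) none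
  else 0

/-- The recursion that starts at `x` and uses the given sets of columns one after the other (each
right-hand side is `A` applied to the previous solution) meets no obstruction. -/
def RecursionUnobstructed : (Word q n → ℝ) → List (Finset (Word q n)) → Prop
  | _, [] => True
  | x, S :: B => Unobstructed dZ ((constraintMatrix q n dZ).mulVec x) S ∧
      RecursionUnobstructed (dinesPoint dZ ((constraintMatrix q n dZ).mulVec x) S) B

/-- The successive solutions of that recursion. -/
noncomputable def recursionPoints :
    (Word q n → ℝ) → List (Finset (Word q n)) → List (Word q n → ℝ)
  | _, [] => []
  | x, S :: B => dinesPoint dZ ((constraintMatrix q n dZ).mulVec x) S ::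
      recursionPoints (dinesPoint dZ ((constraintMatrix q n dZ).mulVec x) S) B

open Classical in
/-- One call of the qudit algorithm on the list `L` of unused columns: start with the first
`2 V_q(d_Z - 1)` columns, and add the next column as long as there is an obstruction. It returns
the solution and the columns that are still unused, or fails when all columns are exhausted. -/
noncomputable def quditCall (b : Fin (numErrorRows q n dZ + 1) → ℝ) (L : List (Word q n)) :
    Option ((Word q n → ℝ) × List (Word q n)) :=
  if h : ∃ k, blockSize q n dZ ≤ k ∧ k ≤ L.length ∧ Unobstructed dZ b (L.take k).toFinset then
    some (dinesPoint dZ b (L.take (Nat.find h)).toFinset, L.drop (Nat.find h))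
  else none

/-- `t` successive calls of the qudit algorithm, each with the right-hand side given by the
previous solution. The result is the list of the `t` solutions, or a failure. -/
noncomputable def quditCalls :
    ℕ → (Word q n → ℝ) → List (Word q n) → Option (List (Word q n → ℝ))
  | 0, _, _ => some []
  | t + 1, x, L =>
      match quditCall dZ ((constraintMatrix q n dZ).mulVec x) L with
      | none => none
      | some (y, L') => (quditCalls t y L').map (fun ys => y :: ys)

/-- A nonzero real solution of `A x = 0` that is supported on the columns in `D`, as used for the
first two logical states. -/
def IsKernelVector (D : Finset (Word q n)) (x : Word q n → ℝ) : Prop :=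
  x ≠ 0 ∧ (∀ c, c ∉ D → x c = 0) ∧ (constraintMatrix q n dZ).mulVec x = 0

/-- The code with the list of codewords `L` (without repetitions) lets the algorithm construct
`t + 2` logical states: `2 V_q(d_Z - 1)` columns `D` and a kernel vector `x` supported on them give
two logical states, and `t` calls of the qudit algorithm on the remaining columns, in their given
order, succeed and give the others. The states form a quantum code with phase-flip distance `dZ`
and with the distance of the classical code as bit-flip distance. -/
def AlgorithmBuilds (L : List (Word q n)) (t : ℕ) : Prop :=
  ∃ (D : Finset (Word q n)) (x : Word q n → ℝ) (ys : List (Word q n → ℝ)),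
    D ⊆ L.toFinset ∧ D.card = blockSize q n dZ ∧ IsKernelVector dZ D x ∧
    quditCalls dZ t x⁻ (L.filter fun c => c ∉ D) = some ys ∧
    (x⁺ :: x⁻ :: ys).length = t + 2 ∧
    ∀ dX, 1 ≤ dX → HasMinDist L.toFinset dX →
      IsQuantumCodeFrom L.toFinset dX dZ (logicalStates (x⁺ :: x⁻ :: ys))

end Recursion

/-! ### Random codes -/

/-- The probability of an event for `m` random words of length `n` all of whose letters are
independent and uniformly distributed, that is, for a uniformly distributed `m`-tuple of words. -/
noncomputable def codeProb (q n m : ℕ) [NeZero q] (E : Set (Fin m → Word q n)) : ENNReal :=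
  (PMF.uniformOfFintype (Fin m → Word q n)).toOuterMeasure E

/-- The codewords of the code `{c 0, …, c (m - 1)}`, listed without repetitions. -/
def codewords {q n m : ℕ} (c : Fin m → Word q n) : List (Word q n) := (List.ofFn c).dedup

/-- The number `⌈q ^ (R n)⌉` of words drawn for a random code of rate `R`. -/
noncomputable def codeSize (q n : ℕ) (R : ℝ) : ℕ := ⌈(q : ℝ) ^ (R * n)⌉₊

end DinesCode

open DinesCode

/-! Dines elimination decides solvability exactly. Back substitution turns nonnegative solutions
into nonnegative solutions, and as long as no row is one-signed some column survives to the last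
system, so the solution found is nonzero (`exists_dinesSolve_pos`). Conversely, every nonnegative
solution lifts through an elimination (`exists_backSubst_eq`), so a system with a nonzero
nonnegative solution meets no one-signed row (`noOneSignedRow_of_solution`). In the augmented system
the first row forces the homogenizing variable to be positive, hence all vectors of the recursion
have the same image under `A`. These equal moments are the Knill-Laflamme conditions for diagonal
Paulis. A Pauli with a shift part of weight below `dX` maps no codeword to a codeword and
contributes nothing.

For random codes the kernel vector is chosen as a difference of two balanced distributions, that is,
distributions whose nontrivial characters of low weight vanish, as they do for the uniform
distribution on all words. Then every call has the same right-hand side, and it succeeds at the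
latest when its columns contain a balanced block (`unobstructed_of_balanced`).

Balanced blocks come from a second moment argument. If `S` is not balanced, separating a point from
a convex hull gives a real trigonometric polynomial of low weight without constant term that is
positive on `S`. Comparing its first two moments over `S` shows that the character sums of `S` are
large (`card_sq_le_discrepancy`). Under a random permutation of the words, however, each nontrivial
character sum of `S` has mean square at most `|S|`, so `S` fails with probability `O(V² / |S|)`,
where `V` is the ball volume. Blocks of `n V²` draws are therefore mostly good, few of their words
are lost to collisions, and `r + 2 Ent(δ) < R` leaves room for enough blocks. The minimum distance
is a first moment bound over pairs of draws. -/

namespace DinesCode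

/-! ### Correctness of the elimination -/

section Elimination

variable {κ : Type} [Fintype κ]

open Classical in
theorem sum_dite_eq_sum_subtype (p : κ → Prop) (f : {k // p k} → ℝ) :
    ∑ k, (if h : p k then f ⟨k, h⟩ else 0) = ∑ k : {k // p k}, f k := by
  rw [← Finset.sum_filter_add_sum_filter_not Finset.univ p]
  rw [Finset.sum_eq_zero (s := Finset.univ.filter fun k => ¬ p k), add_zero]
  · rw [Finset.sum_subtype (Finset.univ.filter p) (p := p) (by simp)]
    exact Finset.sum_congr rfl fun k _ => by simp [k.2]
  · intro k hk
    simp [(Finset.mem_filter.1 hk).2]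

open Classical in
/-- Back substitution: a solution `y` of the system after elimination of the row `a` gives a
solution of the system before. -/
noncomputable def backSubst (a : κ → ℝ) (y : DinesCols a → ℝ) (k : κ) : ℝ :=
  if h0 : a k = 0 then y (Sum.inl ⟨k, h0⟩)
  else if hp : 0 < a k then ∑ j : {j // a j < 0}, -a j * y (Sum.inr (⟨k, hp⟩, j))
  else if hn : a k < 0 then ∑ i : {i // 0 < a i}, a i * y (Sum.inr (i, ⟨k, hn⟩))
  else 0

theorem dinesSolve_succ {r : ℕ} (A : Matrix (Fin (r + 1)) κ ℝ) :
    dinesSolve (r + 1) κ A = backSubst (A 0) (dinesSolve r _ (dinesStep A)) := rfl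

theorem backSubst_nonneg (a : κ → ℝ) {y : DinesCols a → ℝ} (hy : ∀ c, 0 ≤ y c) (k : κ) :
    0 ≤ backSubst a y k := by
  unfold backSubst
  split_ifs with h0 hp hn
  · exact hy _
  · exact Finset.sum_nonneg fun j _ => mul_nonneg (neg_nonneg.2 j.2.le) (hy _)
  · exact Finset.sum_nonneg fun i _ => mul_nonneg i.2.le (hy _)
  · exact le_rfl

/-- A positive variable of a pair `(i, j)` enters the value at `i` with the positive weight `-a j`,
and no other term is negative. -/
theorem exists_backSubst_pos (a : κ → ℝ) {y : DinesCols a → ℝ} (hy : ∀ c, 0 ≤ y c)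
    (hpos : ∃ c, 0 < y c) : ∃ k, 0 < backSubst a y k := by
  obtain ⟨⟨k, h0⟩ | ⟨⟨i, hi⟩, ⟨j, hj⟩⟩, hc⟩ := hpos
  · exact ⟨k, by simpa [backSubst, h0] using hc⟩
  · refine ⟨i, ?_⟩
    simp only [backSubst, hi.ne', hi, dif_neg, dif_pos, not_false_eq_true]
    refine Finset.sum_pos' (fun j _ => mul_nonneg (neg_nonneg.2 j.2.le) (hy _))
      ⟨⟨j, hj⟩, Finset.mem_univ _, mul_pos (neg_pos.2 hj) hc⟩

open Classical in
-- Back substitution is the transpose of elimination, for an arbitrary row `g`. With `g = a` the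
-- pair coefficients cancel; with `g` a later row they are the entries of the eliminated row.
theorem sum_mul_backSubst (a g : κ → ℝ) (y : DinesCols a → ℝ) :
    ∑ k, g k * backSubst a y k = ∑ k : {k // a k = 0}, g k * y (Sum.inl k) +
      ∑ p : {i // 0 < a i} × {j // a j < 0},
        (a p.1 * g p.2 - a p.2 * g p.1) * y (Sum.inr p) := by
  -- Writing the cases as a sum of three dependent conditionals lets each become a sum over a
  -- subtype.
  have key : ∀ k, g k * backSubst a y k =
      (if h : a k = 0 then g k * y (Sum.inl ⟨k, h⟩) else 0) +
      ((if h : 0 < a k then ∑ j : {j // a j < 0}, -a j * g k * y (Sum.inr (⟨k, h⟩, j)) else 0) +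
      (if h : a k < 0 then ∑ i : {i // 0 < a i}, a i * g k * y (Sum.inr (i, ⟨k, h⟩)) else 0)) := by
    intro k
    unfold backSubst
    rcases lt_trichotomy (a k) 0 with h | h | h
    · simp only [h.ne, h.not_gt, h, dif_neg, dif_pos, not_false_eq_true, Finset.mul_sum, zero_add]
      exact Finset.sum_congr rfl fun _ _ => by ring
    · simp [h]
    · simp only [h.ne', h.not_gt, h, dif_neg, dif_pos, not_false_eq_true, Finset.mul_sum, zero_add,
        add_zero]
      exact Finset.sum_congr rfl fun _ _ => by ring
  simp only [key, Finset.sum_add_distrib]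
  rw [sum_dite_eq_sum_subtype _ fun k => g k * y (Sum.inl k),
    sum_dite_eq_sum_subtype _ fun k : {i // 0 < a i} =>
      ∑ j : {j // a j < 0}, -a j * g k * y (Sum.inr (k, j)),
    sum_dite_eq_sum_subtype _ fun k : {j // a j < 0} =>
      ∑ i : {i // 0 < a i}, a i * g k * y (Sum.inr (i, k)), Fintype.sum_prod_type,
    Finset.sum_comm (s := (Finset.univ : Finset {j // a j < 0})), ← Finset.sum_add_distrib]
  congr 1
  refine Finset.sum_congr rfl fun i _ => ?_
  rw [← Finset.sum_add_distrib]
  exact Finset.sum_congr rfl fun j _ => by ring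

end Elimination

open Classical in
theorem sum_dinesStep_mul {κ : Type} [Fintype κ] {r : ℕ} (A : Matrix (Fin (r + 1)) κ ℝ)
    (y : DinesCols (A 0) → ℝ) (s : Fin r) :
    ∑ c, dinesStep A s c * y c = ∑ k, A s.succ k * backSubst (A 0) y k := by
  rw [sum_mul_backSubst, Fintype.sum_sum_type]
  rfl

theorem dinesSolve_nonneg : ∀ (r : ℕ) (κ : Type) [Fintype κ] (A : Matrix (Fin r) κ ℝ) (k : κ),
    0 ≤ dinesSolve r κ A k
  | 0, _, _, _, _ => zero_le_one
  | r + 1, _, _, A, k => backSubst_nonneg _ (fun c => dinesSolve_nonneg r _ (dinesStep A) c) k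

theorem sum_mul_dinesSolve : ∀ (r : ℕ) (κ : Type) [Fintype κ] (A : Matrix (Fin r) κ ℝ)
    (s : Fin r), ∑ k, A s k * dinesSolve r κ A k = 0
  | 0, _, _, _, s => s.elim0
  | r + 1, κ, _, A, s => by
    classical
    rw [dinesSolve_succ]
    refine Fin.cases ?_ (fun s => ?_) s
    · rw [sum_mul_backSubst, Finset.sum_eq_zero, Finset.sum_eq_zero, add_zero]
      · intro p _
        rw [mul_comm (A 0 p.1), sub_self, zero_mul]
      · intro k _
        rw [k.2, zero_mul]
    · rw [← sum_dinesStep_mul]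
      convert sum_mul_dinesSolve r _ (dinesStep A) s

/-- Without zero entries and without pairs of opposite signs, all entries have one sign. The empty
row counts as one-signed too. -/
theorem nonempty_dinesCols {κ : Type} [Nonempty κ] {a : κ → ℝ} (h : ¬ OneSigned a) :
    Nonempty (DinesCols a) := by
  by_contra hne
  rw [not_nonempty_iff, isEmpty_sum, isEmpty_prod] at hne
  obtain ⟨h0, hp | hn⟩ := hne
  · refine h (Or.inr fun k => lt_of_le_of_ne (not_lt.1 fun hk => hp.false ⟨k, hk⟩)
      fun hk => h0.false ⟨k, hk⟩)
  · refine h (Or.inl fun k => lt_of_le_of_ne (not_lt.1 fun hk => hn.false ⟨k, hk⟩)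
      fun hk => h0.false ⟨k, hk.symm⟩)

/-- Columns survive every elimination, the last system has the value `1` on each of them, and back
substitution preserves the existence of a positive entry. -/
theorem exists_dinesSolve_pos : ∀ (r : ℕ) (κ : Type) [Fintype κ] [Nonempty κ]
    (A : Matrix (Fin r) κ ℝ), NoOneSignedRow r κ A → ∃ k, 0 < dinesSolve r κ A k
  | 0, κ, _, _, _, _ => ⟨Classical.arbitrary κ, zero_lt_one⟩
  | r + 1, _, _, _, A, h => by
    have := nonempty_dinesCols (h.1 0)
    exact exists_backSubst_pos _ (fun c => dinesSolve_nonneg r _ (dinesStep A) c)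
      (exists_dinesSolve_pos r _ (dinesStep A) h.2)

/-- Every nonnegative solution of the row `a` lifts to the columns after elimination of `a`. -/
theorem exists_backSubst_eq {κ : Type} [Fintype κ] (a : κ → ℝ) {x : κ → ℝ} (hx : ∀ k, 0 ≤ x k)
    (hax : ∑ k, a k * x k = 0) :
    ∃ y : DinesCols a → ℝ, (∀ c, 0 ≤ y c) ∧ backSubst a y = x := by
  classical
  set P : ℝ := ∑ i : {i // 0 < a i}, a i * x i with hP
  set Q : ℝ := ∑ j : {j // a j < 0}, -a j * x j with hQ
  have hPnn : ∀ i : {i // 0 < a i}, 0 ≤ a i * x i := fun i => mul_nonneg i.2.le (hx _)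
  have hQnn : ∀ j : {j // a j < 0}, 0 ≤ -a j * x j :=
    fun j => mul_nonneg (neg_nonneg.2 j.2.le) (hx _)
  have hPQ : P = Q := by
    have h : ∀ k, a k * x k = (if h : 0 < a k then a k * x k else 0) -
        (if h : a k < 0 then -a k * x k else 0) := by
      intro k
      rcases lt_trichotomy (a k) 0 with h | h | h
      · simp [h, h.not_gt]
      · simp [h]
      · simp [h, h.not_gt]
    rw [Finset.sum_congr rfl fun k _ => h k, Finset.sum_sub_distrib,
      sum_dite_eq_sum_subtype _ fun k : {i // 0 < a i} => a k * x k,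
      sum_dite_eq_sum_subtype _ fun k : {j // a j < 0} => -a k * x k] at hax
    linarith
  have hP0 : 0 ≤ P := Finset.sum_nonneg fun i _ => hPnn i
  -- The mass of the positive columns is distributed over the negative ones proportionally: `P` is
  -- the common value of the positive and the negative part of the equation.
  refine ⟨Sum.elim (fun k => x k) fun p => x p.1 * x p.2 / P, ?_, ?_⟩
  · rintro (k | p)
    · exact hx _
    · exact div_nonneg (mul_nonneg (hx _) (hx _)) hP0
  · funext k
    rcases lt_trichotomy (a k) 0 with h | h | h
    · simp only [backSubst, h.ne, h.not_gt, h, dif_neg, dif_pos, not_false_eq_true, Sum.elim_inr]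
      have : ∑ i : {i // 0 < a i}, a i * (x i * x k / P) = P * (x k / P) := by
        rw [hP, Finset.sum_mul]
        exact Finset.sum_congr rfl fun _ _ => by ring
      rw [this]
      -- If `P = 0` the quotient is `0` by convention, which is right because `x` then vanishes
      -- wherever `a` does not.
      rcases hP0.eq_or_lt with h' | h'
      · have hz : -a k * x k = 0 := (Finset.sum_eq_zero_iff_of_nonneg fun j _ => hQnn j).1
          (hQ ▸ hPQ ▸ h'.symm) ⟨k, h⟩ (Finset.mem_univ _)
        have : x k = 0 := (mul_eq_zero.1 hz).resolve_left (neg_ne_zero.2 h.ne)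
        simp [this]
      · field_simp
    · simp [backSubst, h]
    · simp only [backSubst, h.ne', h, dif_neg, dif_pos, not_false_eq_true, Sum.elim_inr]
      have : ∑ j : {j // a j < 0}, -a j * (x k * x j / P) = Q * (x k / P) := by
        rw [hQ, Finset.sum_mul]
        exact Finset.sum_congr rfl fun _ _ => by ring
      rw [this, ← hPQ]
      rcases hP0.eq_or_lt with h' | h'
      · have hz : a k * x k = 0 := (Finset.sum_eq_zero_iff_of_nonneg fun j _ => hPnn j).1
          (hP ▸ h'.symm) ⟨k, h⟩ (Finset.mem_univ _)
        have : x k = 0 := (mul_eq_zero.1 hz).resolve_left h.ne'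
        simp [this]
      · field_simp

theorem not_oneSigned_of_sum_eq_zero {κ : Type} [Fintype κ] {a x : κ → ℝ} (hx : ∀ k, 0 ≤ x k)
    (hpos : ∃ k, 0 < x k) (hax : ∑ k, a k * x k = 0) : ¬ OneSigned a := by
  obtain ⟨k, hk⟩ := hpos
  rintro (h | h)
  · exact (Finset.sum_pos' (fun i _ => mul_nonneg (h i).le (hx i))
      ⟨k, Finset.mem_univ _, mul_pos (h k) hk⟩).ne' hax
  · have : 0 < ∑ i, -a i * x i :=
      Finset.sum_pos' (fun i _ => mul_nonneg (neg_nonneg.2 (h i).le) (hx i))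
        ⟨k, Finset.mem_univ _, mul_pos (neg_pos.2 (h k)) hk⟩
    simp only [neg_mul, Finset.sum_neg_distrib, hax] at this
    simp at this

/-- A system with a nonzero nonnegative solution meets no one-signed row. -/
theorem noOneSignedRow_of_solution : ∀ (r : ℕ) (κ : Type) [Fintype κ] (A : Matrix (Fin r) κ ℝ)
    (x : κ → ℝ), (∀ k, 0 ≤ x k) → (∃ k, 0 < x k) → (∀ s, ∑ k, A s k * x k = 0) →
    NoOneSignedRow r κ A
  | 0, _, _, _, _, _, _, _ => trivial
  | r + 1, κ, _, A, x, hx, hpos, hA => by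
    classical
    refine ⟨fun s => not_oneSigned_of_sum_eq_zero hx hpos (hA s), ?_⟩
    obtain ⟨y, hy, rfl⟩ := exists_backSubst_eq (A 0) hx (hA 0)
    refine noOneSignedRow_of_solution r _ (dinesStep A) y hy ?_ fun s => ?_
    · by_contra! hneg
      have hy0 : y = 0 := funext fun c => le_antisymm (hneg c) (hy c)
      obtain ⟨k, hk⟩ := hpos
      refine hk.ne' ?_
      subst hy0
      simp [backSubst]
    · rw [sum_dinesStep_mul]
      exact hA s.succ

/-! ### Characters and Pauli operators -/

section Phase

variable {q : ℕ} [NeZero q] {n : ℕ}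

/-- The eigenvalue `ω ^ (z · c)` of `Z^{z₁} ⊗ ⋯ ⊗ Z^{zₙ}` on the basis state of the word `c`. -/
noncomputable def phase (z c : Word q n) : ℂ := ∏ i, ZMod.stdAddChar (z i * c i)

theorem pauliX_pow_apply (k : ℕ) (i j : ZMod q) :
    (pauliX q ^ k) i j = if j = i + k then 1 else 0 := by
  induction k generalizing i with
  | zero => simp [Matrix.one_apply, eq_comm]
  | succ k ih =>
    rw [pow_succ', Matrix.mul_apply, Finset.sum_eq_single (i + 1)]
    · rw [ih, Nat.cast_succ, add_assoc, add_comm 1 (k : ZMod q)]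
      simp [pauliX]
    · intro l _ hl
      simp [pauliX, hl]
    · simp

/-- The natural-number exponents in the Pauli matrices matter only modulo `q`, so the additive
character of `ZMod q` and its multiplicativity become available. -/
theorem exp_pow_val_eq_stdAddChar (x y : ZMod q) :
    (Complex.exp (2 * Real.pi * Complex.I / q) ^ y.val) ^ x.val = ZMod.stdAddChar (x * y) := by
  have h : x * y = ((x.val * y.val : ℕ) : ℤ) := by simp
  rw [h, ZMod.stdAddChar_coe, ← pow_mul, ← Complex.exp_nat_mul]
  congr 1
  push_cast
  ring

/-- `X ^ a` pairs row `s` with column `s + a`. The factor `Z ^ b` stands on the right, so the phase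
is taken at the column `t`. -/
theorem pauli_apply (a b s t : Word q n) :
    pauli a b s t = if t = s + a then phase b t else 0 := by
  have h : ∀ i, (pauliX q ^ (a i).val * pauliZ q ^ (b i).val) (s i) (t i) =
      if t i = s i + a i then ZMod.stdAddChar (b i * t i) else 0 := by
    intro i
    rw [pauliZ, Matrix.diagonal_pow, Matrix.mul_diagonal, pauliX_pow_apply, Pi.pow_apply,
      exp_pow_val_eq_stdAddChar]
    simp
  simp only [pauli, Matrix.of_apply, h, phase]
  split_ifs with hts
  · exact Finset.prod_congr rfl fun i _ => if_pos (by rw [hts, Pi.add_apply])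
  · obtain ⟨i, hi⟩ := Function.ne_iff.1 hts
    exact Finset.prod_eq_zero (Finset.mem_univ i) (if_neg hi)

theorem pauli_zero_apply_self (z c : Word q n) : pauli 0 z c c = phase z c := by
  simp [pauli_apply]

@[simp]
theorem phase_zero_left (c : Word q n) : phase 0 c = 1 := by simp [phase]

theorem phase_add_left (z z' c : Word q n) : phase (z + z') c = phase z c * phase z' c := by
  simp [phase, add_mul, AddChar.map_add_eq_mul, Finset.prod_mul_distrib]

theorem phase_add_right (z c c' : Word q n) : phase z (c + c') = phase z c * phase z c' := by
  simp [phase, mul_add, AddChar.map_add_eq_mul, Finset.prod_mul_distrib]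

theorem norm_phase (z c : Word q n) : ‖phase z c‖ = 1 := by
  rw [phase, norm_prod]
  exact Finset.prod_eq_one fun i _ => Circle.norm_coe _

/-- Phases have modulus `1`, so conjugation is inversion, and `phase (-z) c` is the inverse of
`phase z c`. -/
theorem conj_phase (z c : Word q n) : (starRingEnd ℂ) (phase z c) = phase (-z) c := by
  have h := phase_add_left z (-z) c
  rw [add_neg_cancel, phase_zero_left] at h
  have h2 : phase z c * (starRingEnd ℂ) (phase z c) = 1 := by
    rw [Complex.mul_conj, Complex.normSq_eq_norm_sq, norm_phase]
    simp
  have h0 : phase z c ≠ 0 := fun h0 => by simp [h0] at h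
  exact mul_left_cancel₀ h0 (h2.trans h)

theorem hammingNorm_neg {q n : ℕ} (z : Word q n) : hammingNorm (-z) = hammingNorm z := by
  simp [hammingNorm]

variable (dZ : ℕ)

theorem constraintMatrix_zero (c : Word q n) : constraintMatrix q n dZ 0 c = 1 := rfl

theorem constraintMatrix_succ (s : Fin (numErrorRows q n dZ)) (c : Word q n) :
    constraintMatrix q n dZ s.succ c =
      if ((Fintype.equivFin (ErrorRow q n dZ)).symm s).2 then
        (phase ((Fintype.equivFin (ErrorRow q n dZ)).symm s).1.1 c).im
      else (phase ((Fintype.equivFin (ErrorRow q n dZ)).symm s).1.1 c).re := by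
  simp only [constraintMatrix, Matrix.of_apply, Fin.cons_succ, pauli_zero_apply_self]

theorem constraintMatrix_mulVec_zero (x : Word q n → ℝ) :
    (constraintMatrix q n dZ).mulVec x 0 = ∑ c, x c := by
  simp [Matrix.mulVec, dotProduct, constraintMatrix_zero]

/-- The equations `A x = A y` in terms of characters. -/
theorem constraintMatrix_mulVec_eq_iff (x y : Word q n → ℝ) :
    (constraintMatrix q n dZ).mulVec x = (constraintMatrix q n dZ).mulVec y ↔
      ∀ z : Word q n, hammingNorm z ≤ dZ - 1 →
        ∑ c, (x c : ℂ) * phase z c = ∑ c, (y c : ℂ) * phase z c := by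
  have re_sum : ∀ (x : Word q n → ℝ) z,
      (∑ c, (x c : ℂ) * phase z c).re = ∑ c, (phase z c).re * x c := fun x z => by
    simp [mul_comm]
  have im_sum : ∀ (x : Word q n → ℝ) z,
      (∑ c, (x c : ℂ) * phase z c).im = ∑ c, (phase z c).im * x c := fun x z => by
    simp [mul_comm]
  constructor
  · intro h z hz
    by_cases hz1 : 1 ≤ hammingNorm z
    · have hrow : ∀ b : Bool, ∃ s, constraintMatrix q n dZ s =
          fun c => if b then (phase z c).im else (phase z c).re := fun b => by
        obtain ⟨s, hs⟩ : ∃ s : Fin (numErrorRows q n dZ),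
            (Fintype.equivFin (ErrorRow q n dZ)).symm s = (⟨z, hz1, hz⟩, b) :=
          (Fintype.equivFin (ErrorRow q n dZ)).symm.surjective _
        exact ⟨s.succ, funext fun c => by rw [constraintMatrix_succ, hs]⟩
      apply Complex.ext
      · obtain ⟨s, hs⟩ := hrow false
        have := congrFun h s
        simp only [Matrix.mulVec, hs, dotProduct] at this
        rw [re_sum, re_sum]
        simpa using this
      · obtain ⟨s, hs⟩ := hrow true
        have := congrFun h s
        simp only [Matrix.mulVec, hs, dotProduct] at this
        rw [im_sum, im_sum]
        simpa using this
    -- The trivial character is not an error row; its equation is the all-ones first row.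
    · have hz0 : z = 0 := by
        rw [← hammingNorm_eq_zero]
        omega
      have := congrFun h 0
      rw [constraintMatrix_mulVec_zero, constraintMatrix_mulVec_zero] at this
      subst hz0
      simp only [phase_zero_left, mul_one]
      exact_mod_cast this
  · intro h
    funext s
    refine Fin.cases ?_ (fun s => ?_) s
    · rw [constraintMatrix_mulVec_zero, constraintMatrix_mulVec_zero]
      have := h 0 (by simp)
      simp only [phase_zero_left, mul_one] at this
      exact_mod_cast this
    · simp only [Matrix.mulVec, dotProduct, constraintMatrix_succ]
      have hz := h ((Fintype.equivFin (ErrorRow q n dZ)).symm s).1.1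
        ((Fintype.equivFin (ErrorRow q n dZ)).symm s).1.2.2
      cases ((Fintype.equivFin (ErrorRow q n dZ)).symm s).2
      · simpa [re_sum] using congrArg Complex.re hz
      · simpa [im_sum] using congrArg Complex.im hz

end Phase

/-! ### The Knill-Laflamme conditions -/

section Code

variable {q : ℕ} [NeZero q] {n : ℕ}

theorem logicalState_eq_zero {x : Word q n → ℝ} {c : Word q n} (h : x c = 0) :
    logicalState x c = 0 := by
  simp [logicalState, h]

theorem star_logicalState (x : Word q n → ℝ) (c : Word q n) :
    star (logicalState x c) = logicalState x c := by
  simp [logicalState]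

theorem logicalState_mul_self {x : Word q n → ℝ} (hx : 0 ≤ x) (c : Word q n) :
    logicalState x c * logicalState x c = x c / ((∑ c', x c' : ℝ) : ℂ) := by
  rw [logicalState, ← Complex.ofReal_mul, Real.mul_self_sqrt
    (div_nonneg (hx c) (Finset.sum_nonneg fun c' _ => hx c'))]
  simp

/-- Nonnegative vectors with disjoint supports in a classical code and with the same constraints
give a quantum code. -/
theorem isQuantumCodeFrom_logicalStates {C : Finset (Word q n)} {dX dZ : ℕ} (hdX : 1 ≤ dX)
    (hC : HasMinDist C dX) {x₀ : Word q n → ℝ} (hx₀ : 0 < ∑ c, x₀ c)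
    {xs : List (Word q n → ℝ)} (hnn : ∀ x ∈ xs, 0 ≤ x)
    (hA : ∀ x ∈ xs, (constraintMatrix q n dZ).mulVec x = (constraintMatrix q n dZ).mulVec x₀)
    (hsupp : ∀ x ∈ xs, ∀ c, x c ≠ 0 → c ∈ C)
    (hdisj : xs.Pairwise fun x y => ∀ c, x c = 0 ∨ y c = 0) :
    IsQuantumCodeFrom C dX dZ (logicalStates xs) := by
  have hne : ∀ i j : Fin xs.length, i ≠ j → ∀ c, xs.get i c = 0 ∨ xs.get j c = 0 := by
    intro i j hij c
    rw [List.pairwise_iff_get] at hdisj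
    rcases lt_or_gt_of_ne hij with h | h
    · exact hdisj i j h c
    · exact (hdisj j i h c).symm
  have hsum : ∀ i : Fin xs.length, ∑ c, xs.get i c = ∑ c, x₀ c := fun i => by
    rw [← constraintMatrix_mulVec_zero dZ, ← constraintMatrix_mulVec_zero dZ,
      hA _ (xs.get_mem i)]
  have hz : ∀ (i : Fin xs.length) (c : Word q n), xs.get i c = 0 → logicalStates xs i c = 0 :=
    fun i c h => logicalState_eq_zero h
  -- Squared amplitudes are `x c / ∑ x`, so the expectation of a diagonal Pauli is a moment of `x`
  -- divided by its total mass, and both agree with those of `x₀`.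
  have hdiag : ∀ (b : Word q n), hammingNorm b ≤ dZ - 1 → ∀ i j : Fin xs.length,
      ∑ s, star (logicalStates xs i s) * (phase b s * logicalStates xs j s) =
        if i = j then (∑ c, (x₀ c : ℂ) * phase b c) / ((∑ c, x₀ c : ℝ) : ℂ) else 0 := by
    intro b hb i j
    split_ifs with hij
    · subst hij
      rw [← (constraintMatrix_mulVec_eq_iff dZ _ _).1 (hA _ (xs.get_mem i)) b hb, Finset.sum_div]
      refine Finset.sum_congr rfl fun s _ => ?_
      rw [logicalStates, star_logicalState, mul_left_comm,
        logicalState_mul_self (hnn _ (xs.get_mem i)), hsum]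
      ring
    · refine Finset.sum_eq_zero fun s _ => ?_
      rcases hne i j hij s with h | h <;> simp [hz _ _ h]
  refine ⟨⟨fun j => Finset.univ.filter fun c => xs.get j c ≠ 0,
    fun j c => Real.sqrt (xs.get j c / ∑ c', xs.get j c'), fun j c hc =>
      hsupp _ (xs.get_mem j) c (Finset.mem_filter.1 hc).2, fun i j hij => ?_, fun j c => ?_⟩,
    fun i j => ?_, fun a b ha hb => ?_⟩
  · rw [Finset.disjoint_left]
    intro c hi hj
    rcases hne i j hij c with h | h
    · exact (Finset.mem_filter.1 hi).2 h
    · exact (Finset.mem_filter.1 hj).2 h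
  · by_cases h : xs.get j c = 0
    · rw [if_neg (by simp only [Finset.mem_filter, not_and, not_not]; exact fun _ => h)]
      exact logicalState_eq_zero h
    · rw [if_pos (by simp only [Finset.mem_filter, Finset.mem_univ, true_and]; exact h)]
      rfl
  · have := hdiag 0 (by simp) i j
    simp only [phase_zero_left, one_mul, mul_one] at this
    rw [dotProduct]
    simp only [Pi.star_apply]
    rw [this, ← Complex.ofReal_sum, div_self (by exact_mod_cast hx₀.ne')]
  · have hmv : ∀ j s, (pauli a b).mulVec (logicalStates xs j) s =
        phase b (s + a) * logicalStates xs j (s + a) := by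
      intro j s
      simp [Matrix.mulVec, dotProduct, pauli_apply]
    simp only [dotProduct, Pi.star_apply, hmv]
    by_cases ha0 : a = 0
    · subst ha0
      simp only [add_zero]
      exact ⟨_, hdiag b hb⟩
    · refine ⟨0, fun i j => ?_⟩
      rw [ite_self]
      refine Finset.sum_eq_zero fun s _ => ?_
      by_cases h1 : xs.get i s = 0
      · simp [hz _ _ h1]
      by_cases h2 : xs.get j (s + a) = 0
      · simp [hz _ _ h2]
      -- A nonzero term would need codewords `s` and `s + a` at distance `hammingNorm a ≤ dX - 1`.
      have := hC s (hsupp _ (xs.get_mem i) s h1) (s + a) (hsupp _ (xs.get_mem j) _ h2)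
        (by simpa using ha0)
      rw [hammingDist_eq_hammingNorm, neg_add_cancel_left] at this
      omega

/-! ### The recursion -/

variable (dZ : ℕ)

theorem sum_augmented_mul (b : Fin (numErrorRows q n dZ + 1) → ℝ) (S : Finset (Word q n))
    (x : Option S → ℝ) (s : Fin (numErrorRows q n dZ + 1)) :
    ∑ o, augmented dZ b S s o * x o =
      ∑ c : S, constraintMatrix q n dZ s c * x (some c) - b s * x none := by
  rw [Fintype.sum_option]
  simp only [augmented, Matrix.of_apply]
  ring

/-- The first row contains both `1` and `-b 0 < 0`, so it is never one-signed and elimination yields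
a nonzero solution. That row says that the mass on `S` is `b 0` times the last variable, which is
therefore positive whenever any variable is. -/
theorem dinesSolve_augmented_none_pos {b : Fin (numErrorRows q n dZ + 1) → ℝ}
    {S : Finset (Word q n)} (hS : S.Nonempty) (hb : 0 < b 0) (h : Unobstructed dZ b S) :
    0 < dinesSolve _ _ (augmented dZ b S) none := by
  obtain ⟨c₀, hc₀⟩ := hS
  have hne : ¬ OneSigned (augmented dZ b S 0) := by
    rintro (h | h)
    · have := h none
      simp only [augmented, Matrix.of_apply] at this
      linarith
    · have := h (some ⟨c₀, hc₀⟩)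
      simp only [augmented, Matrix.of_apply, constraintMatrix_zero] at this
      linarith
  obtain ⟨o, ho⟩ := exists_dinesSolve_pos _ _ (augmented dZ b S)
    ⟨Fin.cases hne fun s => h.1 _ (Fin.succ_ne_zero s), h.2⟩
  have hnn := fun o => dinesSolve_nonneg _ _ (augmented dZ b S) o
  cases o with
  | none => exact ho
  | some c =>
    have h0 := sum_mul_dinesSolve _ _ (augmented dZ b S) 0
    rw [sum_augmented_mul] at h0
    simp only [constraintMatrix_zero, one_mul] at h0
    have hpos : 0 < ∑ c : S, dinesSolve _ _ (augmented dZ b S) (some c) :=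
      Finset.sum_pos' (fun c _ => hnn (some c)) ⟨c, Finset.mem_univ _, ho⟩
    exact (pos_iff_pos_of_mul_pos (by linarith)).1 hb

theorem dinesPoint_nonneg (b : Fin (numErrorRows q n dZ + 1) → ℝ) (S : Finset (Word q n)) :
    0 ≤ dinesPoint dZ b S := by
  intro c
  unfold dinesPoint
  split_ifs
  · exact div_nonneg (dinesSolve_nonneg _ _ _ _) (dinesSolve_nonneg _ _ _ _)
  · exact le_rfl

theorem dinesPoint_of_notMem (b : Fin (numErrorRows q n dZ + 1) → ℝ) {S : Finset (Word q n)}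
    {c : Word q n} (hc : c ∉ S) : dinesPoint dZ b S c = 0 := dif_neg hc

theorem constraintMatrix_mulVec_dinesPoint {b : Fin (numErrorRows q n dZ + 1) → ℝ}
    {S : Finset (Word q n)} (hS : S.Nonempty) (hb : 0 < b 0) (h : Unobstructed dZ b S) :
    (constraintMatrix q n dZ).mulVec (dinesPoint dZ b S) = b := by
  funext s
  have ht := dinesSolve_augmented_none_pos dZ hS hb h
  have h0 := sum_mul_dinesSolve _ _ (augmented dZ b S) s
  rw [sum_augmented_mul, sub_eq_zero] at h0
  rw [eq_comm, ← eq_div_iff ht.ne'] at h0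
  rw [h0, Matrix.mulVec, dotProduct, Finset.sum_div,
    ← Finset.sum_subset (Finset.subset_univ S) fun c _ hc => by
      rw [dinesPoint_of_notMem dZ b hc, mul_zero], ← Finset.sum_coe_sort S]
  refine Finset.sum_congr rfl fun c _ => ?_
  rw [dinesPoint, dif_pos c.2, mul_div_assoc]

theorem length_recursionPoints (x : Word q n → ℝ) (B : List (Finset (Word q n))) :
    (recursionPoints dZ x B).length = B.length := by
  induction B generalizing x with
  | nil => rfl
  | cons S B ih => simp [recursionPoints, ih]

theorem nonneg_of_mem_recursionPoints {x y : Word q n → ℝ} {B : List (Finset (Word q n))}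
    (hy : y ∈ recursionPoints dZ x B) : 0 ≤ y := by
  induction B generalizing x with
  | nil => simp [recursionPoints] at hy
  | cons S B ih =>
    rw [recursionPoints, List.mem_cons] at hy
    rcases hy with rfl | hy
    · exact dinesPoint_nonneg dZ _ S
    · exact ih hy

theorem exists_mem_of_mem_recursionPoints {x y : Word q n → ℝ} {B : List (Finset (Word q n))}
    (hy : y ∈ recursionPoints dZ x B) : ∃ S ∈ B, ∀ c, c ∉ S → y c = 0 := by
  induction B generalizing x with
  | nil => simp [recursionPoints] at hy
  | cons S B ih =>
    rw [recursionPoints, List.mem_cons] at hy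
    rcases hy with rfl | hy
    · exact ⟨S, List.mem_cons_self, fun c hc => dinesPoint_of_notMem dZ _ hc⟩
    · obtain ⟨T, hT, h⟩ := ih hy
      exact ⟨T, List.mem_cons_of_mem _ hT, h⟩

/-- The image under `A`, and with it the positive total mass that makes the next step work, is an
invariant of the recursion. -/
theorem mulVec_eq_of_mem_recursionPoints {x y : Word q n → ℝ} {B : List (Finset (Word q n))}
    (hx : 0 < ∑ c, x c) (hB : ∀ S ∈ B, S.Nonempty) (h : RecursionUnobstructed dZ x B)
    (hy : y ∈ recursionPoints dZ x B) :
    (constraintMatrix q n dZ).mulVec y = (constraintMatrix q n dZ).mulVec x := by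
  induction B generalizing x with
  | nil => simp [recursionPoints] at hy
  | cons S B ih =>
    rw [recursionPoints, List.mem_cons] at hy
    have hS := constraintMatrix_mulVec_dinesPoint dZ (hB S List.mem_cons_self)
      (by rwa [constraintMatrix_mulVec_zero]) h.1
    rcases hy with rfl | hy
    · exact hS
    · rw [ih (x := dinesPoint dZ ((constraintMatrix q n dZ).mulVec x) S) ?_
        (fun T hT => hB T (List.mem_cons_of_mem _ hT)) h.2 hy, hS]
      rwa [← constraintMatrix_mulVec_zero dZ, hS, constraintMatrix_mulVec_zero]

theorem pairwise_recursionPoints (x : Word q n → ℝ) {B : List (Finset (Word q n))}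
    (hB : B.Pairwise Disjoint) :
    (recursionPoints dZ x B).Pairwise fun x y => ∀ c, x c = 0 ∨ y c = 0 := by
  induction B generalizing x with
  | nil => exact List.Pairwise.nil
  | cons S B ih =>
    rw [List.pairwise_cons] at hB
    refine List.Pairwise.cons (fun y hy c => ?_) (ih _ hB.2)
    obtain ⟨T, hT, h⟩ := exists_mem_of_mem_recursionPoints dZ hy
    by_cases hc : c ∈ S
    · exact Or.inr (h c (Finset.disjoint_left.1 (hB.1 T hT) hc))
    · exact Or.inl (dinesPoint_of_notMem dZ _ hc)

theorem ballVolume_pos (q n d : ℕ) : 0 < ballVolume q n d := by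
  rw [ballVolume, Finset.sum_range_succ']
  simp

theorem blockSize_pos (q n dZ : ℕ) : 0 < blockSize q n dZ :=
  Nat.mul_pos two_pos (ballVolume_pos _ _ _)

/-- The recursion gives a quantum code as long as it meets no obstruction. -/
theorem isQuantumCodeFrom_recursion {dX : ℕ} {C D : Finset (Word q n)} {x : Word q n → ℝ}
    {B : List (Finset (Word q n))} (hdX : 1 ≤ dX) (hC : HasMinDist C dX) (hDC : D ⊆ C)
    (hx : IsKernelVector dZ D x)
    (hB : ∀ S ∈ B, S ⊆ C ∧ Disjoint D S ∧ blockSize q n dZ ≤ S.card)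
    (hBd : B.Pairwise Disjoint) (hun : RecursionUnobstructed dZ x⁻ B) :
    IsQuantumCodeFrom C dX dZ (logicalStates (x⁺ :: x⁻ :: recursionPoints dZ x⁻ B)) := by
  obtain ⟨hx0, hxD, hxA⟩ := hx
  have hpn : (constraintMatrix q n dZ).mulVec x⁺ = (constraintMatrix q n dZ).mulVec x⁻ := by
    rw [← sub_eq_zero, ← Matrix.mulVec_sub, posPart_sub_negPart, hxA]
  have hor : ∀ c, x⁺ c = 0 ∨ x⁻ c = 0 := fun c => by
    rw [Pi.posPart_apply, Pi.negPart_apply, posPart_eq_zero, negPart_eq_zero]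
    exact le_total _ _
  -- By the first row both parts of `x` have the same mass, so if one were massless, `x` would
  -- vanish.
  have hpos : 0 < ∑ c, x⁻ c := by
    refine (Finset.sum_nonneg fun c _ => negPart_nonneg x c).lt_of_ne fun h => hx0 ?_
    have hp : ∑ c, x⁺ c = 0 := by
      rw [← constraintMatrix_mulVec_zero dZ, hpn, constraintMatrix_mulVec_zero, ← h]
    rw [← posPart_sub_negPart x]
    funext c
    rw [Pi.sub_apply,
      (Finset.sum_eq_zero_iff_of_nonneg fun c _ => negPart_nonneg x c).1 h.symm c
        (Finset.mem_univ c),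
      (Finset.sum_eq_zero_iff_of_nonneg fun c _ => posPart_nonneg x c).1 hp c
        (Finset.mem_univ c)]
    simp
  have hBne : ∀ S ∈ B, S.Nonempty := fun S hS =>
    Finset.card_pos.1 ((blockSize_pos q n dZ).trans_le (hB S hS).2.2)
  have hsuppD : ∀ c, c ∉ D → x⁺ c = 0 ∧ x⁻ c = 0 := fun c hc => by
    simp [Pi.posPart_apply, Pi.negPart_apply, hxD c hc]
  have hsuppB : ∀ y ∈ recursionPoints dZ x⁻ B, ∀ c, c ∈ D → y c = 0 := fun y hy c hc => by
    obtain ⟨S, hS, h⟩ := exists_mem_of_mem_recursionPoints dZ hy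
    exact h c (Finset.disjoint_left.1 (hB S hS).2.1 hc)
  refine isQuantumCodeFrom_logicalStates hdX hC hpos ?_ ?_ ?_ ?_
  · simp only [List.mem_cons]
    rintro y (rfl | rfl | hy)
    · exact posPart_nonneg x
    · exact negPart_nonneg x
    · exact nonneg_of_mem_recursionPoints dZ hy
  · simp only [List.mem_cons]
    rintro y (rfl | rfl | hy)
    · exact hpn
    · rfl
    · exact mulVec_eq_of_mem_recursionPoints dZ hpos hBne hun hy
  · simp only [List.mem_cons]
    rintro y (rfl | rfl | hy) c hc
    · exact hDC (by_contra fun h => hc (hsuppD c h).1)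
    · exact hDC (by_contra fun h => hc (hsuppD c h).2)
    · obtain ⟨S, hS, h⟩ := exists_mem_of_mem_recursionPoints dZ hy
      exact (hB S hS).1 (by_contra fun h' => hc (h c h'))
  · rw [List.pairwise_cons, List.pairwise_cons]
    refine ⟨fun y hy c => ?_, fun y hy c => ?_, pairwise_recursionPoints dZ _ hBd⟩
    · rw [List.mem_cons] at hy
      rcases hy with rfl | hy
      · exact hor c
      · by_cases hc : c ∈ D
        · exact Or.inr (hsuppB y hy c hc)
        · exact Or.inl (hsuppD c hc).1
    · by_cases hc : c ∈ D
      · exact Or.inr (hsuppB y hy c hc)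
      · exact Or.inl (hsuppD c hc).2

end Code

/-! ### Hamming balls -/

section Ball

variable {q : ℕ} [NeZero q] {n : ℕ}

theorem card_filter_support_eq (s : Finset (Fin n)) :
    (Finset.univ.filter fun z : Word q n => (Finset.univ.filter fun i => z i ≠ 0) = s).card =
      (q - 1) ^ s.card := by
  have h : (Finset.univ.filter fun z : Word q n => (Finset.univ.filter fun i => z i ≠ 0) = s) =
      Fintype.piFinset fun i => if i ∈ s then Finset.univ.erase 0 else {0} := by
    ext z
    simp only [Finset.mem_filter, Finset.mem_univ, true_and, Fintype.mem_piFinset, Finset.ext_iff]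
    refine forall_congr' fun i => ?_
    split_ifs with hi <;> simp [hi]
  rw [h, Fintype.card_piFinset, ← Finset.prod_subset (Finset.subset_univ s) fun i _ hi => by
    simp [hi], Finset.prod_congr rfl fun i hi => by
      rw [if_pos hi, Finset.card_erase_of_mem (Finset.mem_univ _), Finset.card_univ, ZMod.card],
    Finset.prod_const]

theorem card_filter_hammingNorm_eq (w : ℕ) :
    (Finset.univ.filter fun z : Word q n => hammingNorm z = w).card =
      n.choose w * (q - 1) ^ w := by
  rw [Finset.card_eq_sum_card_fiberwise
    (f := fun z : Word q n => Finset.univ.filter fun i => z i ≠ 0)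
    (t := Finset.powersetCard w Finset.univ) (fun z hz => by
      simpa [Finset.mem_powersetCard, hammingNorm] using hz)]
  rw [Finset.sum_congr rfl fun s hs => ?_, Finset.sum_const, Finset.card_powersetCard,
    Finset.card_univ, Fintype.card_fin, smul_eq_mul]
  rw [Finset.mem_powersetCard] at hs
  rw [← hs.2, ← card_filter_support_eq, Finset.filter_filter]
  congr 1
  ext z
  simp only [Finset.mem_filter, Finset.mem_univ, true_and, hammingNorm, and_iff_right_iff_imp]
  rintro rfl
  rfl

theorem card_filter_hammingNorm_le (r : ℕ) :
    (Finset.univ.filter fun z : Word q n => hammingNorm z ≤ r).card = ballVolume q n r := by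
  rw [Finset.card_eq_sum_card_fiberwise (f := hammingNorm) (t := Finset.range (r + 1))
    (fun z hz => by simpa [Nat.lt_succ_iff] using hz), ballVolume]
  refine Finset.sum_congr rfl fun w hw => ?_
  rw [← card_filter_hammingNorm_eq, Finset.filter_filter]
  congr 1
  ext z
  simp only [Finset.mem_filter, Finset.mem_univ, true_and, and_iff_right_iff_imp]
  rintro rfl
  exact Nat.lt_succ_iff.1 (Finset.mem_range.1 hw)

/-- The words of weight at most `dZ - 1`. -/
def lowWords (q n dZ : ℕ) [NeZero q] : Finset (Word q n) :=
  Finset.univ.filter fun z => hammingNorm z ≤ dZ - 1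

theorem mem_lowWords {dZ : ℕ} {z : Word q n} : z ∈ lowWords q n dZ ↔ hammingNorm z ≤ dZ - 1 := by
  simp [lowWords]

theorem card_lowWords (dZ : ℕ) : (lowWords q n dZ).card = ballVolume q n (dZ - 1) :=
  card_filter_hammingNorm_le _

theorem zero_mem_lowWords (dZ : ℕ) : (0 : Word q n) ∈ lowWords q n dZ := by
  simp [mem_lowWords]

theorem neg_mem_lowWords {dZ : ℕ} {z : Word q n} :
    -z ∈ lowWords q n dZ ↔ z ∈ lowWords q n dZ := by
  rw [mem_lowWords, mem_lowWords, hammingNorm_neg]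

theorem sum_lowWords_neg {dZ : ℕ} (f : Word q n → ℂ) :
    ∑ z ∈ lowWords q n dZ, f (-z) = ∑ z ∈ lowWords q n dZ, f z :=
  Finset.sum_equiv (Equiv.neg _) (fun z => by simp [neg_mem_lowWords]) fun z _ => rfl

end Ball

/-! ### Balanced sets of words -/

section Balanced

variable {q : ℕ} [NeZero q] {n : ℕ} (dZ : ℕ)

/-- A probability distribution on words whose nontrivial characters of weight below `dZ`
vanish. -/
def IsBalancedWeight (w : Word q n → ℝ) : Prop :=
  0 ≤ w ∧ ∀ z ∈ lowWords q n dZ, ∑ c, (w c : ℂ) * phase z c = if z = 0 then 1 else 0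

/-- A set of words that carries a balanced distribution. -/
def Balanced (S : Finset (Word q n)) : Prop :=
  ∃ w : Word q n → ℝ, IsBalancedWeight dZ w ∧ ∀ c, c ∉ S → w c = 0

variable {dZ}

theorem IsBalancedWeight.sum_eq_one {w : Word q n → ℝ} (hw : IsBalancedWeight dZ w) :
    ∑ c, w c = 1 := by
  have := hw.2 0 (zero_mem_lowWords dZ)
  simp only [phase_zero_left, mul_one, if_true] at this
  exact_mod_cast this

theorem IsBalancedWeight.mulVec_eq {w w' : Word q n → ℝ} (hw : IsBalancedWeight dZ w)
    (hw' : IsBalancedWeight dZ w') :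
    (constraintMatrix q n dZ).mulVec w = (constraintMatrix q n dZ).mulVec w' := by
  rw [constraintMatrix_mulVec_eq_iff]
  intro z hz
  rw [hw.2 z (mem_lowWords.2 hz), hw'.2 z (mem_lowWords.2 hz)]

/-- Balance depends only on the image under `A`, so it passes from each solution of the recursion to
the next. -/
theorem IsBalancedWeight.of_mulVec_eq {w w' : Word q n → ℝ} (hw : IsBalancedWeight dZ w)
    (hw' : 0 ≤ w')
    (h : (constraintMatrix q n dZ).mulVec w' = (constraintMatrix q n dZ).mulVec w) :
    IsBalancedWeight dZ w' := by
  refine ⟨hw', fun z hz => ?_⟩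
  rw [(constraintMatrix_mulVec_eq_iff dZ _ _).1 h z (mem_lowWords.1 hz), hw.2 z hz]

theorem Balanced.mono {S T : Finset (Word q n)} (h : Balanced dZ S) (hST : S ⊆ T) :
    Balanced dZ T := by
  obtain ⟨w, hw, hwS⟩ := h
  exact ⟨w, hw, fun c hc => hwS c fun h => hc (hST h)⟩

/-- More words than characters admit a real linear relation. -/
theorem exists_real_relation {T : Finset (Word q n)} (hT : ballVolume q n (dZ - 1) < T.card) :
    ∃ x : Word q n → ℝ, x ≠ 0 ∧ (∀ c, c ∉ T → x c = 0) ∧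
      ∀ z ∈ lowWords q n dZ, ∑ c, (x c : ℂ) * phase z c = 0 := by
  let f : (T → ℂ) →ₗ[ℂ] (lowWords q n dZ → ℂ) :=
    Matrix.mulVecLin (Matrix.of fun z c => phase z.1 c.1)
  have hf : LinearMap.ker f ≠ ⊥ := LinearMap.ker_ne_bot_of_finrank_lt (by
    simpa [Module.finrank_fintype_fun_eq_card, card_lowWords] using hT)
  obtain ⟨l, hl, hl0⟩ := (Submodule.ne_bot_iff _).1 hf
  let L : Word q n → ℂ := fun c => if h : c ∈ T then l ⟨c, h⟩ else 0
  have hLT : ∀ c, c ∉ T → L c = 0 := fun c hc => dif_neg hc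
  have hL : ∀ z ∈ lowWords q n dZ, ∑ c, L c * phase z c = 0 := by
    intro z hz
    have := congrFun (LinearMap.mem_ker.1 hl) ⟨z, hz⟩
    rw [← Finset.sum_subset (Finset.subset_univ T) fun c _ hc => by rw [hLT c hc, zero_mul],
      ← Finset.sum_coe_sort T]
    refine Eq.trans ?_ this
    simp only [f, Matrix.mulVecLin_apply, Matrix.mulVec, dotProduct, Matrix.of_apply]
    exact Finset.sum_congr rfl fun c _ => by rw [mul_comm]; simp [L]
  -- Low words are closed under negation, so the conjugate of a relation is a relation. The real and
  -- the imaginary part are then relations too, and one of them is nonzero.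
  have hLconj : ∀ z ∈ lowWords q n dZ, ∑ c, (starRingEnd ℂ) (L c) * phase z c = 0 := by
    intro z hz
    have := congrArg (starRingEnd ℂ) (hL (-z) (neg_mem_lowWords.2 hz))
    simpa [map_sum, conj_phase] using this
  by_cases hre : (fun c => (L c).re) = 0
  · refine ⟨fun c => (L c).im, fun him => hl0 ?_, fun c hc => by simp [hLT c hc], fun z hz => ?_⟩
    · funext c
      have h1 := congrFun hre c
      have h2 := congrFun him c
      have : L c = 0 := Complex.ext h1 h2
      simpa [L] using this
    · have : ∀ c, ((L c).im : ℂ) * phase z c =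
          (L c * phase z c - (starRingEnd ℂ) (L c) * phase z c) * (1 / (2 * Complex.I)) := by
        intro c
        rw [Complex.im_eq_sub_conj]
        field_simp
      simp only [this]
      rw [← Finset.sum_mul, Finset.sum_sub_distrib, hL z hz, hLconj z hz]
      simp
  · refine ⟨fun c => (L c).re, hre, fun c hc => by simp [hLT c hc], fun z hz => ?_⟩
    have : ∀ c, ((L c).re : ℂ) * phase z c =
        (L c * phase z c + (starRingEnd ℂ) (L c) * phase z c) * (1 / 2) := by
      intro c
      rw [Complex.re_eq_add_conj]
      ring
    simp only [this]
    rw [← Finset.sum_mul, Finset.sum_add_distrib, hL z hz, hLconj z hz]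
    simp

/-- A balanced set carries a balanced distribution with at most as many words in its support as
there are characters. -/
theorem Balanced.exists_card_le {S : Finset (Word q n)} (h : Balanced dZ S) :
    ∃ (w : Word q n → ℝ) (T : Finset (Word q n)), IsBalancedWeight dZ w ∧
      (∀ c, c ∉ T → w c = 0) ∧ T ⊆ S ∧ T.card ≤ ballVolume q n (dZ - 1) := by
  induction hk : S.card using Nat.strong_induction_on generalizing S with
  | _ k ih =>
    obtain ⟨w, hw, hwS⟩ := h
    by_cases hS : S.card ≤ ballVolume q n (dZ - 1)
    · exact ⟨w, S, hw, hwS, Finset.Subset.refl S, hS⟩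
    obtain ⟨x, hx0, hxS, hx⟩ := exists_real_relation (dZ := dZ) (not_le.1 hS)
    have hsum : ∑ c, x c = 0 := by
      have := hx 0 (zero_mem_lowWords dZ)
      simp only [phase_zero_left, mul_one] at this
      exact_mod_cast this
    have hpos : (S.filter fun c => 0 < x c).Nonempty := by
      by_contra hne
      rw [Finset.not_nonempty_iff_eq_empty, Finset.filter_eq_empty_iff] at hne
      have hle : ∀ c, x c ≤ 0 := fun c => by
        by_cases hc : c ∈ S
        · exact not_lt.1 (hne hc)
        · exact (hxS c hc).le
      exact hx0 (funext fun c =>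
        (Finset.sum_eq_zero_iff_of_nonpos fun c _ => hle c).1 hsum c (Finset.mem_univ c))
    -- Carathéodory's argument: moving against `x` until the first weight vanishes keeps the weights
    -- nonnegative and all moments fixed, and removes `c₀` from the support.
    obtain ⟨c₀, hc₀, hmin⟩ := Finset.exists_min_image _ (fun c => w c / x c) hpos
    rw [Finset.mem_filter] at hc₀
    have hθ : 0 ≤ w c₀ / x c₀ := div_nonneg (hw.1 c₀) hc₀.2.le
    have hbal : Balanced dZ (S.erase c₀) := by
      refine ⟨fun c => w c - w c₀ / x c₀ * x c, ⟨fun c => ?_, fun z hz => ?_⟩, fun c hc => ?_⟩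
      · rw [Pi.zero_apply, sub_nonneg]
        by_cases hxc : 0 < x c
        · have hcS : c ∈ S := by_contra fun h => hxc.ne' (hxS c h)
          exact (le_div_iff₀ hxc).1 (hmin c (Finset.mem_filter.2 ⟨hcS, hxc⟩))
        · exact (mul_nonpos_of_nonneg_of_nonpos hθ (not_lt.1 hxc)).trans (hw.1 c)
      · have : ∀ c, ((w c - w c₀ / x c₀ * x c : ℝ) : ℂ) * phase z c =
            (w c : ℂ) * phase z c - ((w c₀ / x c₀ : ℝ) : ℂ) * ((x c : ℂ) * phase z c) := by
          intro c
          push_cast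
          ring
        simp only [this]
        rw [Finset.sum_sub_distrib, ← Finset.mul_sum, hw.2 z hz, hx z hz, mul_zero, sub_zero]
      · by_cases hcc : c = c₀
        · subst hcc
          have := hc₀.2.ne'
          field_simp
          ring
        · have hcS : c ∉ S := fun h => hc (Finset.mem_erase.2 ⟨hcc, h⟩)
          simp [hwS c hcS, hxS c hcS]
    obtain ⟨w', T, hw', hwT, hTS, hT⟩ := ih _ (by
      rw [Finset.card_erase_of_mem hc₀.1]
      have := Finset.card_pos.2 ⟨c₀, hc₀.1⟩
      omega) hbal rfl
    exact ⟨w', T, hw', hwT, hTS.trans (Finset.erase_subset _ _), hT⟩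

end Balanced

/-! ### A second moment criterion -/

section Discrepancy

variable {q : ℕ} [NeZero q] {n : ℕ} (dZ : ℕ)

/-- The character sum of a set of words. -/
noncomputable def charSum (S : Finset (Word q n)) (z : Word q n) : ℂ := ∑ c ∈ S, phase z c

/-- The total size of the character sums of `S` that have to be small for `S` to be balanced. -/
noncomputable def discrepancy (S : Finset (Word q n)) : ℝ :=
  ∑ p ∈ (lowWords q n dZ).offDiag, ‖charSum S (p.1 - p.2)‖ ^ 2 +
    ballVolume q n (dZ - 1) * ∑ z ∈ (lowWords q n dZ).erase 0, ‖charSum S z‖ ^ 2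

variable {dZ}

/-- A positive trigonometric polynomial without constant term forces a large discrepancy. -/
theorem card_sq_le_discrepancy {S : Finset (Word q n)} (hS : S.Nonempty) {a : Word q n → ℂ}
    (ha0 : a 0 = 0) {g : Word q n → ℝ}
    (hg : ∀ c, (g c : ℂ) = ∑ z ∈ lowWords q n dZ, a z * phase z c) (hpos : ∀ c ∈ S, 0 < g c) :
    (S.card : ℝ) ^ 2 ≤ 2 * discrepancy dZ S := by
  set W := lowWords q n dZ with hW
  set N : ℝ := ∑ z ∈ W, ‖a z‖ ^ 2 with hN
  set V : ℝ := (ballVolume q n (dZ - 1) : ℝ) with hV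
  set E₁ : ℝ := ∑ z ∈ W.erase 0, ‖charSum S z‖ ^ 2 with hE₁
  set E₂ : ℝ := ∑ p ∈ W.offDiag, ‖charSum S (p.1 - p.2)‖ ^ 2 with hE₂
  have hN0 : 0 ≤ N := Finset.sum_nonneg fun z _ => by positivity
  have hE₁0 : 0 ≤ E₁ := Finset.sum_nonneg fun z _ => by positivity
  have hE₂0 : 0 ≤ E₂ := Finset.sum_nonneg fun z _ => by positivity
  have hV0 : 0 ≤ V := Nat.cast_nonneg _
  have hcard : (W.card : ℝ) = V := by rw [hV, hW, card_lowWords]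
  -- Cauchy-Schwarz over the at most `V` frequencies.
  have hbound : ∀ c, g c ≤ √(V * N) := by
    intro c
    have h1 : g c ≤ ∑ z ∈ W, ‖a z‖ := by
      calc g c ≤ ‖(g c : ℂ)‖ := by
            rw [Complex.norm_real]
            exact le_abs_self _
        _ ≤ ∑ z ∈ W, ‖a z * phase z c‖ := by
            rw [hg]
            exact norm_sum_le _ _
        _ = ∑ z ∈ W, ‖a z‖ := by simp [norm_phase]
    refine h1.trans (Real.le_sqrt_of_sq_le ?_)
    rw [← hcard]
    exact sq_sum_le_card_mul_sum_sq
  -- Without a constant term, the first moment involves only nontrivial character sums.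
  have hfirst : ∑ c ∈ S, g c ≤ √(N * E₁) := by
    have h1 : ((∑ c ∈ S, g c : ℝ) : ℂ) = ∑ z ∈ W.erase 0, a z * charSum S z := by
      push_cast
      simp only [hg]
      rw [Finset.sum_comm, ← Finset.add_sum_erase W _ (zero_mem_lowWords dZ)]
      simp [ha0, charSum, Finset.mul_sum]
    have h2 : ∑ c ∈ S, g c ≤ ∑ z ∈ W.erase 0, ‖a z‖ * ‖charSum S z‖ := by
      calc ∑ c ∈ S, g c ≤ ‖((∑ c ∈ S, g c : ℝ) : ℂ)‖ := by
            rw [Complex.norm_real]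
            exact le_abs_self _
        _ ≤ _ := by
            rw [h1]
            exact (norm_sum_le _ _).trans_eq (Finset.sum_congr rfl fun z _ => norm_mul _ _)
    refine h2.trans (Real.le_sqrt_of_sq_le ((Finset.sum_mul_sq_le_sq_mul_sq _ _ _).trans ?_))
    refine mul_le_mul_of_nonneg_right ?_ hE₁0
    exact Finset.sum_le_sum_of_subset_of_nonneg (Finset.erase_subset _ _)
      fun z _ _ => by positivity
  -- In the expansion of `g ^ 2` the diagonal pairs of frequencies give `S.card * N`; the others
  -- give character sums at differences of low words.
  have hsecond : S.card * N ≤ ∑ c ∈ S, g c ^ 2 + N * √E₂ := by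
    have h1 : ((∑ c ∈ S, g c ^ 2 : ℝ) : ℂ) =
        ((S.card * N : ℝ) : ℂ) +
          ∑ p ∈ W.offDiag, a p.1 * (starRingEnd ℂ) (a p.2) * charSum S (p.1 - p.2) := by
      have h2 : ∀ c, ((g c ^ 2 : ℝ) : ℂ) = ∑ p ∈ W ×ˢ W,
          a p.1 * (starRingEnd ℂ) (a p.2) * phase (p.1 - p.2) c := by
        intro c
        have : ((g c ^ 2 : ℝ) : ℂ) = (g c : ℂ) * (starRingEnd ℂ) (g c : ℂ) := by
          rw [Complex.conj_ofReal]
          push_cast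
          ring
        rw [this, hg, map_sum, Finset.sum_mul_sum, Finset.sum_product]
        refine Finset.sum_congr rfl fun z _ => Finset.sum_congr rfl fun z' _ => ?_
        rw [map_mul, conj_phase, sub_eq_add_neg, phase_add_left]
        ring
      rw [Complex.ofReal_sum]
      simp only [h2]
      rw [Finset.sum_comm, ← Finset.diag_union_offDiag,
        Finset.sum_union (Finset.disjoint_diag_offDiag W), Finset.sum_diag]
      congr 1
      · simp only [sub_self, phase_zero_left, Complex.mul_conj, Complex.normSq_eq_norm_sq, hN]
        push_cast
        rw [Finset.mul_sum]
        simp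
      · exact Finset.sum_congr rfl fun p _ => by rw [charSum, Finset.mul_sum]
    have h2 : ‖∑ p ∈ W.offDiag, a p.1 * (starRingEnd ℂ) (a p.2) * charSum S (p.1 - p.2)‖ ≤
        N * √E₂ := by
      have h3 : ‖∑ p ∈ W.offDiag, a p.1 * (starRingEnd ℂ) (a p.2) * charSum S (p.1 - p.2)‖ ≤
          ∑ p ∈ W.offDiag, (‖a p.1‖ * ‖a p.2‖) * ‖charSum S (p.1 - p.2)‖ :=
        (norm_sum_le _ _).trans_eq (Finset.sum_congr rfl fun p _ => by
          rw [norm_mul, norm_mul, RCLike.norm_conj])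
      refine h3.trans ?_
      rw [← Real.sqrt_sq hN0, ← Real.sqrt_mul (sq_nonneg N)]
      refine Real.le_sqrt_of_sq_le ((Finset.sum_mul_sq_le_sq_mul_sq _ _ _).trans ?_)
      refine mul_le_mul_of_nonneg_right ?_ hE₂0
      calc ∑ p ∈ W.offDiag, (‖a p.1‖ * ‖a p.2‖) ^ 2
          ≤ ∑ p ∈ W ×ˢ W, (‖a p.1‖ * ‖a p.2‖) ^ 2 :=
            Finset.sum_le_sum_of_subset_of_nonneg (fun p hp => by
              rw [Finset.mem_offDiag] at hp
              exact Finset.mem_product.2 ⟨hp.1, hp.2.1⟩) fun p _ _ => by positivity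
        _ = N ^ 2 := by
            rw [Finset.sum_product, sq N, hN, Finset.sum_mul_sum]
            simp only [mul_pow]
    have h3 : (S.card * N : ℝ) = ∑ c ∈ S, g c ^ 2 - (∑ p ∈ W.offDiag,
        a p.1 * (starRingEnd ℂ) (a p.2) * charSum S (p.1 - p.2)).re := by
      have := congrArg Complex.re h1
      rw [Complex.add_re, Complex.ofReal_re, Complex.ofReal_re] at this
      linarith
    have h4 := (abs_le.1 (Complex.abs_re_le_norm (∑ p ∈ W.offDiag,
        a p.1 * (starRingEnd ℂ) (a p.2) * charSum S (p.1 - p.2)))).1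
    linarith
  -- Positivity on `S` is used here: the second moment is at most the maximum of `g` times its first
  -- moment.
  have hmix : ∑ c ∈ S, g c ^ 2 ≤ √(V * N) * √(N * E₁) := by
    calc ∑ c ∈ S, g c ^ 2 ≤ ∑ c ∈ S, √(V * N) * g c := by
          refine Finset.sum_le_sum fun c hc => ?_
          rw [sq]
          exact mul_le_mul_of_nonneg_right (hbound c) (hpos c hc).le
      _ = √(V * N) * ∑ c ∈ S, g c := (Finset.mul_sum _ _ _).symm
      _ ≤ _ := mul_le_mul_of_nonneg_left hfirst (Real.sqrt_nonneg _)
  have hsq : √(V * N) * √(N * E₁) = N * √(V * E₁) := by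
    rw [← Real.sqrt_mul (by positivity), show V * N * (N * E₁) = N ^ 2 * (V * E₁) by ring,
      Real.sqrt_mul (by positivity), Real.sqrt_sq hN0]
  have hNpos : 0 < N := by
    refine hN0.lt_of_ne fun h => ?_
    obtain ⟨c, hc⟩ := hS
    have := hbound c
    rw [← h, mul_zero, Real.sqrt_zero] at this
    exact (hpos c hc).not_ge this
  have hfin : (S.card : ℝ) ≤ √E₂ + √(V * E₁) := by
    refine le_of_mul_le_mul_right ?_ hNpos
    linarith
  have hA := Real.sq_sqrt hE₂0
  have hB := Real.sq_sqrt (mul_nonneg hV0 hE₁0)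
  calc (S.card : ℝ) ^ 2 ≤ (√E₂ + √(V * E₁)) ^ 2 :=
        pow_le_pow_left₀ (Nat.cast_nonneg _) hfin 2
    _ ≤ 2 * (E₂ + V * E₁) := by
        have := sq_nonneg (√E₂ - √(V * E₁))
        nlinarith
    _ = 2 * discrepancy dZ S := rfl

/-- Sets of small discrepancy are balanced. -/
theorem balanced_of_discrepancy_lt {S : Finset (Word q n)}
    (hS : 2 * discrepancy dZ S < (S.card : ℝ) ^ 2) : Balanced dZ S := by
  set W := lowWords q n dZ with hW
  let Φ : Word q n → (W → ℂ) := fun c z => phase z.1 c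
  let e : W → ℂ := fun z => if z.1 = 0 then 1 else 0
  have hSne : S.Nonempty := by
    by_contra hne
    rw [Finset.not_nonempty_iff_eq_empty] at hne
    subst hne
    simp [discrepancy, charSum] at hS
  -- Being balanced means that the moment vector `e` of the uniform distribution is a convex
  -- combination of the character vectors of `S`.
  by_cases he : e ∈ convexHull ℝ (Φ '' S)
  · rw [Set.image_eq_range] at he
    obtain ⟨w, hw0, hw1, hwe⟩ : ∃ w : S → ℝ, (∀ c, 0 ≤ w c) ∧ ∑ c, w c = 1 ∧
        ∑ c, w c • Φ c = e := by
      rw [convexHull_range_eq_exists_affineCombination] at he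
      obtain ⟨s, w, hw0, hw1, hwe⟩ := he
      rw [Finset.affineCombination_eq_linear_combination _ _ _ hw1] at hwe
      refine ⟨fun c => if c ∈ s then w c else 0, fun c => ?_, ?_, ?_⟩
      · dsimp only
        split_ifs with h
        · exact hw0 c h
        · exact le_rfl
      · rw [Finset.sum_ite_mem, Finset.univ_inter, hw1]
      · simp only [ite_smul, zero_smul]
        rw [Finset.sum_ite_mem, Finset.univ_inter, ← hwe]
        rfl
    refine ⟨fun c => if h : c ∈ S then w ⟨c, h⟩ else 0, ⟨fun c => ?_, fun z hz => ?_⟩,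
      fun c hc => dif_neg hc⟩
    · simp only [Pi.zero_apply]
      split_ifs
      · exact hw0 _
      · exact le_rfl
    · have := congrFun hwe ⟨z, hz⟩
      simp only [Finset.sum_apply, Pi.smul_apply, Φ, e] at this
      rw [← this, ← Finset.sum_subset (Finset.subset_univ S) fun c _ hc => by simp [hc],
        ← Finset.sum_coe_sort S]
      exact Finset.sum_congr rfl fun c _ => by simp
  exfalso
  obtain ⟨f, u, hfu, hue⟩ := geometric_hahn_banach_closed_point (convex_convexHull ℝ _)
    ((S.finite_toSet.image Φ).isClosed_convexHull ℝ) he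
  -- Complex coefficients of the real functional: `f v` is twice the real part of `∑ b z * v z`.
  let b : Word q n → ℂ := fun z => if h : z ∈ W then
    ((f (Pi.single ⟨z, h⟩ 1) : ℂ) - Complex.I * f (Pi.single ⟨z, h⟩ Complex.I)) / 2 else 0
  have hfb : ∀ v : W → ℂ, (f v : ℂ) = ∑ z : W, (b z * v z + (starRingEnd ℂ) (b z * v z)) := by
    intro v
    have h1 : v = ∑ z : W, ((v z).re • (Pi.single z 1 : W → ℂ) +
        (v z).im • (Pi.single z Complex.I : W → ℂ)) := by
      funext z
      rw [Finset.sum_apply, Finset.sum_eq_single z]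
      · simp
      · intro z' _ hz'
        simp [Pi.single_eq_of_ne hz'.symm]
      · simp
    conv_lhs => rw [h1]
    rw [map_sum, Complex.ofReal_sum]
    refine Finset.sum_congr rfl fun z _ => ?_
    rw [Complex.add_conj]
    simp [b]
    ring
  -- Symmetrizing under `z ↦ -z` makes `f (Φ c)` a trigonometric polynomial. Its constant term
  -- equals `f e`, so it cancels in `f e - f (Φ c)`, which is positive on `S`.
  let a : Word q n → ℂ := fun z => if z = 0 then 0 else -(b z + (starRingEnd ℂ) (b (-z)))
  have hfΦ : ∀ c, (f (Φ c) : ℂ) = ∑ z ∈ W, (b z + (starRingEnd ℂ) (b (-z))) * phase z c := by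
    intro c
    rw [hfb, Finset.sum_coe_sort W fun z => b z * phase z c + (starRingEnd ℂ) (b z * phase z c),
      Finset.sum_add_distrib, ← sum_lowWords_neg fun z => (starRingEnd ℂ) (b z * phase z c),
      ← Finset.sum_add_distrib]
    refine Finset.sum_congr rfl fun z _ => ?_
    rw [map_mul, conj_phase, neg_neg]
    ring
  have hfe : (f e : ℂ) = b 0 + (starRingEnd ℂ) (b 0) := by
    rw [hfb, Finset.sum_coe_sort W fun z => b z * (if z = 0 then 1 else 0) +
      (starRingEnd ℂ) (b z * (if z = 0 then 1 else 0)), Finset.sum_eq_single 0]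
    · simp
    · intro z _ hz
      simp [hz]
    · exact fun h => (h (zero_mem_lowWords dZ)).elim
  refine hS.not_ge (card_sq_le_discrepancy hSne (a := a) (g := fun c => f e - f (Φ c))
    (if_pos rfl) (fun c => ?_) fun c hc => ?_)
  · push_cast
    rw [hfe, hfΦ, ← Finset.add_sum_erase W _ (zero_mem_lowWords dZ),
      ← Finset.add_sum_erase W _ (zero_mem_lowWords dZ)]
    simp only [neg_zero, phase_zero_left, mul_one, a, if_true, zero_add, sub_add_cancel_left]
    rw [← Finset.sum_neg_distrib]
    refine Finset.sum_congr rfl fun z hz => ?_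
    rw [if_neg (Finset.ne_of_mem_erase hz)]
    ring
  · have := hfu (Φ c) (subset_convexHull ℝ _ ⟨c, hc, rfl⟩)
    simp only [sub_pos]
    linarith

/-! ### Averages over permutations of the words -/

/-- Translation by a unit vector where `z` is nonzero multiplies the sum by a phase different from
`1`. -/
theorem sum_phase_eq_zero {z : Word q n} (hz : z ≠ 0) : ∑ c, phase z c = 0 := by
  obtain ⟨i, hi⟩ := Function.ne_iff.1 hz
  have h1 : phase z (Pi.single i 1) ≠ 1 := by
    rw [phase, Finset.prod_eq_single i]
    · rw [Pi.single_eq_same, mul_one, ← AddChar.map_zero_eq_one (ZMod.stdAddChar (N := q))]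
      exact fun h => hi (ZMod.injective_stdAddChar h)
    · intro j _ hj
      simp [hj]
    · simp
  have h2 : ∑ c, phase z c = (∑ c, phase z c) * phase z (Pi.single i 1) := by
    rw [Finset.sum_mul, ← Equiv.sum_comp (Equiv.addRight (Pi.single i 1 : Word q n))]
    exact Finset.sum_congr rfl fun c _ => phase_add_right _ _ _
  by_contra h
  exact h1 (mul_left_cancel₀ h (h2.symm.trans (mul_one _).symm))

/-- Under a random permutation of the words, the values of a nontrivial character at different
words are negatively correlated. -/
theorem sum_perm_phase_mul_conj_nonpos {z : Word q n} (hz : z ≠ 0) {c c' : Word q n}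
    (h : c ≠ c') :
    (∑ π : Equiv.Perm (Word q n), phase z (π c) * (starRingEnd ℂ) (phase z (π c'))).re ≤ 0 := by
  -- By symmetry `G` is constant off `c`; its total vanishes with the full character sum, and `G c`
  -- is nonnegative, so the common value is not positive.
  let G : Word q n → ℝ := fun d =>
    (∑ π : Equiv.Perm (Word q n), phase z (π c) * (starRingEnd ℂ) (phase z (π d))).re
  have hconst : ∀ d, d ≠ c → G d = G c' := by
    intro d hd
    simp only [G]
    congr 1
    rw [← Equiv.sum_comp (Equiv.mulRight (Equiv.swap d c'))]
    refine Finset.sum_congr rfl fun π _ => ?_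
    simp only [Equiv.coe_mulRight, Equiv.Perm.mul_apply, Equiv.swap_apply_left]
    rw [Equiv.swap_apply_of_ne_of_ne hd.symm h]
  have hsum : ∑ d, G d = 0 := by
    simp only [G]
    rw [← Complex.re_sum, Finset.sum_comm, Finset.sum_eq_zero, Complex.zero_re]
    intro π _
    rw [← Finset.mul_sum, ← map_sum, Equiv.sum_comp π (phase z), sum_phase_eq_zero hz, map_zero,
      mul_zero]
  have hself : 0 ≤ G c := by
    simp only [G, Complex.re_sum]
    refine Finset.sum_nonneg fun π _ => ?_
    rw [Complex.mul_conj, Complex.ofReal_re]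
    exact Complex.normSq_nonneg _
  rw [← Finset.add_sum_erase _ _ (Finset.mem_univ c),
    Finset.sum_congr rfl fun d hd => hconst d (Finset.ne_of_mem_erase hd), Finset.sum_const,
    nsmul_eq_mul] at hsum
  have hcard : 0 < ((Finset.univ.erase c).card : ℝ) :=
    Nat.cast_pos.2 (Finset.card_pos.2 ⟨c', Finset.mem_erase.2 ⟨h.symm, Finset.mem_univ _⟩⟩)
  change G c' ≤ 0
  by_contra! hG
  have := mul_pos hcard hG
  linarith

/-- Expanding the square, each diagonal term contributes `1` per permutation, and the negative
correlation lets the other terms be dropped. -/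
theorem sum_perm_norm_charSum_sq_le (S : Finset (Word q n)) {z : Word q n} (hz : z ≠ 0) :
    ∑ π : Equiv.Perm (Word q n), ‖charSum (S.map π.toEmbedding) z‖ ^ 2 ≤
      Fintype.card (Equiv.Perm (Word q n)) * S.card := by
  have h1 : ∀ π : Equiv.Perm (Word q n), ‖charSum (S.map π.toEmbedding) z‖ ^ 2 =
      ∑ c ∈ S, ∑ c' ∈ S, (phase z (π c) * (starRingEnd ℂ) (phase z (π c'))).re := by
    intro π
    rw [charSum, Finset.sum_map, ← Complex.normSq_eq_norm_sq,
      ← Complex.ofReal_re (Complex.normSq _), ← Complex.mul_conj, map_sum, Finset.sum_mul_sum]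
    simp only [Complex.re_sum]
    rfl
  simp only [h1]
  rw [Finset.sum_comm, mul_comm, ← nsmul_eq_mul, ← Finset.sum_const]
  refine Finset.sum_le_sum fun c hc => ?_
  rw [Finset.sum_comm, ← Finset.add_sum_erase _ _ hc]
  have h2 : ∑ π : Equiv.Perm (Word q n), (phase z (π c) * (starRingEnd ℂ) (phase z (π c))).re =
      Fintype.card (Equiv.Perm (Word q n)) := by
    simp [Complex.mul_conj, Complex.normSq_eq_norm_sq, norm_phase]
  rw [h2]
  have h3 : ∑ c' ∈ S.erase c, ∑ π : Equiv.Perm (Word q n),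
      (phase z (π c) * (starRingEnd ℂ) (phase z (π c'))).re ≤ 0 := by
    refine Finset.sum_nonpos fun c' hc' => ?_
    rw [← Complex.re_sum]
    exact sum_perm_phase_mul_conj_nonpos hz (Finset.ne_of_mem_erase hc').symm
  linarith

/-- Both parts of the discrepancy consist of at most `V ^ 2` squared nontrivial character sums,
counted with multiplicity, each with average at most `S.card`. -/
theorem sum_perm_discrepancy_le (S : Finset (Word q n)) :
    ∑ π : Equiv.Perm (Word q n), discrepancy dZ (S.map π.toEmbedding) ≤
      Fintype.card (Equiv.Perm (Word q n)) *
        (2 * (ballVolume q n (dZ - 1) : ℝ) ^ 2 * S.card) := by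
  set P : ℝ := Fintype.card (Equiv.Perm (Word q n)) * S.card with hP
  set V : ℝ := (ballVolume q n (dZ - 1) : ℝ) with hV
  have hP0 : 0 ≤ P := by positivity
  have hcard : ((lowWords q n dZ).card : ℝ) = V := by rw [card_lowWords]
  simp only [discrepancy]
  rw [Finset.sum_add_distrib, ← Finset.mul_sum, Finset.sum_comm,
    Finset.sum_comm (t := (lowWords q n dZ).erase 0)]
  have h1 : ∑ p ∈ (lowWords q n dZ).offDiag, ∑ π : Equiv.Perm (Word q n),
      ‖charSum (S.map π.toEmbedding) (p.1 - p.2)‖ ^ 2 ≤ V ^ 2 * P := by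
    calc _ ≤ ∑ p ∈ (lowWords q n dZ).offDiag, P := Finset.sum_le_sum fun p hp =>
          sum_perm_norm_charSum_sq_le S (sub_ne_zero.2 (Finset.mem_offDiag.1 hp).2.2)
      _ = ((lowWords q n dZ).offDiag.card : ℝ) * P := by rw [Finset.sum_const, nsmul_eq_mul]
      _ ≤ V ^ 2 * P := by
          refine mul_le_mul_of_nonneg_right ?_ hP0
          rw [← hcard, Finset.offDiag_card, sq]
          exact_mod_cast Nat.sub_le _ _
  have h2 : ∑ z ∈ (lowWords q n dZ).erase 0, ∑ π : Equiv.Perm (Word q n),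
      ‖charSum (S.map π.toEmbedding) z‖ ^ 2 ≤ V * P := by
    calc _ ≤ ∑ z ∈ (lowWords q n dZ).erase 0, P := Finset.sum_le_sum fun z hz =>
          sum_perm_norm_charSum_sq_le S (Finset.ne_of_mem_erase hz)
      _ = (((lowWords q n dZ).erase 0).card : ℝ) * P := by rw [Finset.sum_const, nsmul_eq_mul]
      _ ≤ V * P := by
          refine mul_le_mul_of_nonneg_right ?_ hP0
          rw [← hcard]
          exact_mod_cast Finset.card_erase_le
  have h3 := mul_le_mul_of_nonneg_left h2 (show 0 ≤ V from Nat.cast_nonneg _)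
  have h4 : V ^ 2 * P + V * (V * P) =
      Fintype.card (Equiv.Perm (Word q n)) * (2 * V ^ 2 * S.card) := by
    rw [hP]
    ring
  linarith

end Discrepancy

/-! ### The algorithm succeeds on lists with many balanced blocks -/

section Algorithm

variable {q : ℕ} [NeZero q] {n : ℕ} (dZ : ℕ)

/-- The list has `t` disjoint balanced blocks of consecutive words, each of at least
`blockSize q n dZ` words. -/
inductive HasBlocks : ℕ → List (Word q n) → Prop
  | zero (L : List (Word q n)) : HasBlocks 0 L
  | succ (t : ℕ) (L₀ L₁ L₂ : List (Word q n)) (hbal : Balanced dZ L₁.toFinset)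
      (hlen : blockSize q n dZ ≤ L₁.toFinset.card) (h : HasBlocks t L₂) :
      HasBlocks (t + 1) (L₀ ++ (L₁ ++ L₂))

variable {dZ}

theorem HasBlocks.append_left {t : ℕ} {L : List (Word q n)} (h : HasBlocks dZ t L)
    (L₀ : List (Word q n)) : HasBlocks dZ t (L₀ ++ L) := by
  cases h with
  | zero => exact HasBlocks.zero _
  | succ t L₁ L₂ L₃ hbal hlen h =>
    rw [← List.append_assoc]
    exact HasBlocks.succ t _ _ _ hbal hlen h

theorem HasBlocks.of_suffix {t : ℕ} {L L' : List (Word q n)} (h : HasBlocks dZ t L)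
    (hs : L <:+ L') : HasBlocks dZ t L' := by
  obtain ⟨L₀, rfl⟩ := hs
  exact h.append_left L₀

theorem HasBlocks.of_le {t t' : ℕ} {L : List (Word q n)} (h : HasBlocks dZ t L) (ht : t' ≤ t) :
    HasBlocks dZ t' L := by
  induction h generalizing t' with
  | zero L =>
    obtain rfl : t' = 0 := by omega
    exact HasBlocks.zero L
  | succ t L₀ L₁ L₂ hbal hlen _ ih =>
    cases t' with
    | zero => exact HasBlocks.zero _
    | succ t' => exact HasBlocks.succ t' _ _ _ hbal hlen (ih (by omega))

/-- A balanced set of columns makes the system with a balanced right-hand side unobstructed. -/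
theorem unobstructed_of_balanced {x : Word q n → ℝ} (hx : IsBalancedWeight dZ x)
    {S : Finset (Word q n)} (hS : Balanced dZ S) :
    Unobstructed dZ ((constraintMatrix q n dZ).mulVec x) S := by
  obtain ⟨w, hw, hwS⟩ := hS
  -- The balanced weight on `S`, with homogenizing variable `1`, solves the augmented system.
  have h := noOneSignedRow_of_solution _ _
    (augmented dZ ((constraintMatrix q n dZ).mulVec x) S)
    (fun o => o.elim 1 fun c => w c) ?_ ⟨none, zero_lt_one⟩ ?_
  · exact ⟨fun s _ => h.1 s, h.2⟩
  · rintro (_ | c)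
    · exact zero_le_one
    · exact hw.1 c
  · intro s
    rw [sum_augmented_mul, hx.mulVec_eq hw, Matrix.mulVec, dotProduct, sub_eq_zero]
    simp only [Option.elim, mul_one]
    rw [Finset.sum_coe_sort S fun c => constraintMatrix q n dZ s c * w c]
    exact Finset.sum_subset (Finset.subset_univ S) fun c _ hc => by rw [hwS c hc, mul_zero]

/-- The prefix that ends with `L₁` contains a balanced set, so the search stops there or earlier.
The bound on `k` leaves `L₂` untouched for later calls. -/
theorem quditCall_eq_some {x : Word q n → ℝ} (hx : IsBalancedWeight dZ x)
    (L₀ L₁ L₂ : List (Word q n)) (hbal : Balanced dZ L₁.toFinset)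
    (hlen : blockSize q n dZ ≤ L₁.toFinset.card) :
    ∃ k, blockSize q n dZ ≤ k ∧ k ≤ L₀.length + L₁.length ∧
      Unobstructed dZ ((constraintMatrix q n dZ).mulVec x)
        ((L₀ ++ (L₁ ++ L₂)).take k).toFinset ∧
      quditCall dZ ((constraintMatrix q n dZ).mulVec x) (L₀ ++ (L₁ ++ L₂)) =
        some (dinesPoint dZ ((constraintMatrix q n dZ).mulVec x)
          ((L₀ ++ (L₁ ++ L₂)).take k).toFinset, (L₀ ++ (L₁ ++ L₂)).drop k) := by
  classical
  have hk : blockSize q n dZ ≤ L₀.length + L₁.length ∧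
      L₀.length + L₁.length ≤ (L₀ ++ (L₁ ++ L₂)).length ∧
      Unobstructed dZ ((constraintMatrix q n dZ).mulVec x)
        ((L₀ ++ (L₁ ++ L₂)).take (L₀.length + L₁.length)).toFinset := by
    refine ⟨(hlen.trans L₁.toFinset_card_le).trans (Nat.le_add_left _ _), ?_, ?_⟩
    · simp only [List.length_append]
      omega
    · refine unobstructed_of_balanced hx (hbal.mono ?_)
      rw [← List.append_assoc, ← List.length_append, List.take_left, List.toFinset_append]
      exact Finset.subset_union_right
  have hex : ∃ k, blockSize q n dZ ≤ k ∧ k ≤ (L₀ ++ (L₁ ++ L₂)).length ∧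
      Unobstructed dZ ((constraintMatrix q n dZ).mulVec x)
        ((L₀ ++ (L₁ ++ L₂)).take k).toFinset := ⟨_, hk⟩
  have hspec := Nat.find_spec hex
  refine ⟨Nat.find hex, hspec.1, Nat.find_min' hex hk, hspec.2.2, ?_⟩
  rw [quditCall, dif_pos hex]

theorem sum_pos_of_isBalancedWeight {x : Word q n → ℝ} (hx : IsBalancedWeight dZ x) :
    0 < (constraintMatrix q n dZ).mulVec x 0 := by
  rw [constraintMatrix_mulVec_zero, hx.sum_eq_one]
  exact zero_lt_one

/-- The calls of the algorithm succeed, and follow the recursion for suitable column sets. -/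
theorem exists_quditCalls_eq_some {t : ℕ} {L : List (Word q n)} (hL : L.Nodup)
    (h : HasBlocks dZ t L) {x : Word q n → ℝ} (hx : IsBalancedWeight dZ x) :
    ∃ B : List (Finset (Word q n)), B.length = t ∧
      quditCalls dZ t x L = some (recursionPoints dZ x B) ∧ RecursionUnobstructed dZ x B ∧
      B.Pairwise Disjoint ∧ ∀ S ∈ B, S ⊆ L.toFinset ∧ blockSize q n dZ ≤ S.card := by
  induction t generalizing L x with
  | zero => exact ⟨[], rfl, rfl, trivial, List.Pairwise.nil, by simp⟩
  | succ t ih =>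
    cases h with
    | succ _ L₀ L₁ L₂ hbal hlen h =>
      obtain ⟨k, hk1, hk2, hun, hcall⟩ := quditCall_eq_some hx L₀ L₁ L₂ hbal hlen
      set L := L₀ ++ (L₁ ++ L₂) with hLdef
      have hkL : k ≤ L.length := by
        simp only [hLdef, List.length_append]
        omega
      set S := (L.take k).toFinset with hS
      have hScard : S.card = k := by
        rw [hS, List.toFinset_card_of_nodup (hL.sublist (List.take_sublist _ _)),
          List.length_take, min_eq_left hkL]
      have hSne : S.Nonempty := Finset.card_pos.1 (hScard ▸ (blockSize_pos q n dZ).trans_le hk1)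
      have hdrop : HasBlocks dZ t (L.drop k) := by
        refine h.of_suffix ?_
        have h2 : L₂ = L.drop (L₀.length + L₁.length) := by
          rw [hLdef, ← List.append_assoc, ← List.length_append, List.drop_left]
        rw [h2, ← Nat.sub_add_cancel hk2, Nat.add_comm, ← List.drop_drop]
        exact List.drop_suffix _ _
      have hy : IsBalancedWeight dZ (dinesPoint dZ ((constraintMatrix q n dZ).mulVec x) S) :=
        hx.of_mulVec_eq (dinesPoint_nonneg dZ _ S)
          (constraintMatrix_mulVec_dinesPoint dZ hSne (sum_pos_of_isBalancedWeight hx) hun)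
      obtain ⟨B, hB1, hB2, hB3, hB4, hB5⟩ := ih (hL.sublist (List.drop_sublist _ _)) hdrop hy
      refine ⟨S :: B, by simp [hB1], ?_, ⟨hun, hB3⟩, List.Pairwise.cons (fun T hT => ?_) hB4, ?_⟩
      · rw [quditCalls, hcall]
        simp only [hB2, Option.map_some, recursionPoints]
      · refine Finset.disjoint_of_subset_right (hB5 T hT).1 ?_
        rw [List.disjoint_toFinset_iff_disjoint]
        exact List.disjoint_take_drop hL le_rfl
      · intro T hT
        rw [List.mem_cons] at hT
        rcases hT with rfl | hT
        · refine ⟨?_, hScard ▸ hk1⟩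
          exact fun c hc => List.mem_toFinset.2 (List.take_subset _ _ (List.mem_toFinset.1 hc))
        · refine ⟨(hB5 T hT).1.trans ?_, (hB5 T hT).2⟩
          exact fun c hc => List.mem_toFinset.2 (List.drop_subset _ _ (List.mem_toFinset.1 hc))

theorem posPart_sub_of_disjoint {ι : Type*} {w w' : ι → ℝ} (hw : 0 ≤ w) (hw' : 0 ≤ w')
    (h : ∀ c, w c = 0 ∨ w' c = 0) : (w - w')⁺ = w ∧ (w - w')⁻ = w' := by
  constructor <;> funext c
  · rcases h c with h | h
    · simpa [Pi.posPart_apply, h] using hw' c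
    · simpa [Pi.posPart_apply, h] using hw c
  · rcases h c with h | h
    · simpa [Pi.negPart_apply, h] using hw' c
    · simpa [Pi.negPart_apply, h] using hw c

/-- The algorithm succeeds on lists with many balanced blocks. -/
theorem algorithmBuilds_of_hasBlocks {t : ℕ} {L : List (Word q n)} (hL : L.Nodup)
    (h : HasBlocks dZ (t + 2) L) : AlgorithmBuilds dZ L t := by
  -- The first two blocks are spent on the kernel vector, the other `t` on the calls.
  obtain ⟨L₀, L₁, L₂, L₃, L₄, hb₁, hl₁, hb₂, hL₄, rfl⟩ : ∃ L₀ L₁ L₂ L₃ L₄ : List (Word q n),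
      Balanced dZ L₁.toFinset ∧ blockSize q n dZ ≤ L₁.toFinset.card ∧ Balanced dZ L₃.toFinset ∧
        HasBlocks dZ t L₄ ∧ L = L₀ ++ (L₁ ++ (L₂ ++ (L₃ ++ L₄))) := by
    cases h with
    | succ _ L₀ L₁ _ hb₁ hl₁ h =>
      cases h with
      | succ _ L₂ L₃ L₄ hb₂ hl₂ h => exact ⟨L₀, L₁, L₂, L₃, L₄, hb₁, hl₁, hb₂, h, rfl⟩
  set L := L₀ ++ (L₁ ++ (L₂ ++ (L₃ ++ L₄))) with hLdef
  obtain ⟨w, T, hw, hwT, hT, hTc⟩ := hb₁.exists_card_le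
  obtain ⟨w', T', hw', hwT', hT', hTc'⟩ := hb₂.exists_card_le
  have hnd := hL
  rw [hLdef, List.nodup_append', List.nodup_append', List.nodup_append', List.nodup_append'] at hnd
  obtain ⟨-, ⟨-, ⟨-, ⟨-, -, h34⟩, -⟩, h1⟩, -⟩ := hnd
  have hd : Disjoint L₁.toFinset L₃.toFinset := by
    rw [List.disjoint_toFinset_iff_disjoint]
    exact fun c hc hc' => h1 hc (by simp [hc'])
  have hdw : ∀ c, w c = 0 ∨ w' c = 0 := fun c => by
    by_cases hc : c ∈ T
    · exact Or.inr (hwT' c fun hc' => Finset.disjoint_left.1 hd (hT hc) (hT' hc'))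
    · exact Or.inl (hwT c hc)
  -- The two small supports have at most `2 V` words together. Padding to exactly `blockSize` words
  -- inside the two blocks keeps `D` away from `L₄`.
  obtain ⟨D, hDT, hDL, hDc⟩ := Finset.exists_subsuperset_card_eq
    (s := T ∪ T') (t := L₁.toFinset ∪ L₃.toFinset) (n := blockSize q n dZ)
    (Finset.union_subset_union hT hT')
    ((Finset.card_union_le _ _).trans (by rw [blockSize]; omega))
    (hl₁.trans (Finset.card_le_card Finset.subset_union_left))
  obtain ⟨hp, hm⟩ := posPart_sub_of_disjoint hw.1 hw'.1 hdw
  have hD4 : ∀ c ∈ L₄, c ∉ D := by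
    intro c hc hcD
    have := hDL hcD
    rw [Finset.mem_union, List.mem_toFinset, List.mem_toFinset] at this
    rcases this with h | h
    · exact h1 h (by simp [hc])
    · exact h34 h hc
  have hfilter : HasBlocks dZ t (L.filter fun c => c ∉ D) := by
    have : L₄.filter (fun c => c ∉ D) = L₄ :=
      List.filter_eq_self.2 fun c hc => by simpa using hD4 c hc
    rw [hLdef]
    simp only [List.filter_append, this]
    exact (((hL₄.append_left _).append_left _).append_left _).append_left _
  obtain ⟨B, hB1, hB2, hB3, hB4, hB5⟩ :=
    exists_quditCalls_eq_some (hL.filter _) hfilter hw'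
  have hDL' : D ⊆ L.toFinset := by
    intro c hc
    have := hDL hc
    rw [Finset.mem_union, List.mem_toFinset, List.mem_toFinset] at this
    rw [List.mem_toFinset, hLdef]
    rcases this with h | h <;> simp [h]
  have hker : IsKernelVector dZ D (w - w') := by
    refine ⟨fun h0 => ?_, fun c hc => ?_, ?_⟩
    · rw [h0] at hp
      have := hw.sum_eq_one
      rw [← hp] at this
      simp at this
    · have h1 : c ∉ T := fun h => hc (hDT (Finset.mem_union_left _ h))
      have h2 : c ∉ T' := fun h => hc (hDT (Finset.mem_union_right _ h))
      simp [hwT c h1, hwT' c h2]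
    · rw [Matrix.mulVec_sub, hw.mulVec_eq hw', sub_self]
  refine ⟨D, w - w', recursionPoints dZ w' B, hDL', hDc, hker, by rw [hm, hB2], ?_, ?_⟩
  · simp [length_recursionPoints, hB1]
  · intro dX hdX hdist
    have hrec := isQuantumCodeFrom_recursion dZ (B := B) hdX hdist hDL' hker (fun S hS => ?_) hB4
      (by rwa [hm])
    · rwa [hm] at hrec ⊢
    · refine ⟨(hB5 S hS).1.trans ?_, ?_, (hB5 S hS).2⟩
      · intro c hc
        rw [List.mem_toFinset] at hc ⊢
        exact List.mem_of_mem_filter hc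
      · rw [Finset.disjoint_right]
        intro c hc
        have := (hB5 S hS).1 hc
        rw [List.mem_toFinset, List.mem_filter] at this
        simpa using this.2

end Algorithm

/-! ### Random words -/

section Random

variable {q : ℕ} [NeZero q] {n : ℕ}

/-- Markov's inequality for random codes. -/
theorem le_codeProb {m : ℕ} {E : Set (Fin m → Word q n)} {X : (Fin m → Word q n) → ℝ} {ε : ℝ}
    (hX : ∀ c, 0 ≤ X c) (hE : ∀ c, c ∉ E → 1 ≤ X c)
    (hsum : ∑ c, X c ≤ Fintype.card (Fin m → Word q n) * ε) :
    1 - ENNReal.ofReal ε ≤ codeProb q n m E := by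
  classical
  have hΩ : (0 : ℝ) < Fintype.card (Fin m → Word q n) := Nat.cast_pos.2 Fintype.card_pos
  have hε : 0 ≤ ε := by
    refine nonneg_of_mul_nonneg_right ((Finset.sum_nonneg fun c _ => hX c).trans hsum) hΩ
  have hcompl : (Fintype.card (Fin m → Word q n) : ℝ) - (Finset.univ.filter (· ∈ E)).card ≤
      Fintype.card (Fin m → Word q n) * ε := by
    refine le_trans ?_ hsum
    rw [sub_le_iff_le_add']
    calc (Fintype.card (Fin m → Word q n) : ℝ)
        = ∑ c : Fin m → Word q n, (1 : ℝ) := by simp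
      _ ≤ ∑ c : Fin m → Word q n, ((if c ∈ E then 1 else 0) + X c) := by
          refine Finset.sum_le_sum fun c _ => ?_
          split_ifs with h
          · linarith [hX c]
          · linarith [hE c h]
      _ = _ := by
          rw [Finset.sum_add_distrib, Finset.sum_boole]
  have hprob : codeProb q n m E = ENNReal.ofReal
      ((Finset.univ.filter (· ∈ E)).card / Fintype.card (Fin m → Word q n)) := by
    rw [codeProb, PMF.toOuterMeasure_uniformOfFintype_apply, ENNReal.ofReal_div_of_pos hΩ,
      ENNReal.ofReal_natCast, ENNReal.ofReal_natCast, Fintype.card_subtype]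
  rw [hprob, ← ENNReal.ofReal_one, ← ENNReal.ofReal_sub _ hε]
  refine ENNReal.ofReal_le_ofReal ?_
  rw [le_div_iff₀ hΩ]
  linarith

/-- The difference of two independent random words is uniformly distributed. -/
theorem card_mul_sum_sub {ι : Type*} [Fintype ι] [DecidableEq ι] {i l : ι} (h : i ≠ l)
    (f : Word q n → ℝ) :
    Fintype.card (Word q n) * ∑ c : ι → Word q n, f (c i - c l) =
      Fintype.card (ι → Word q n) * ∑ a, f a := by
  have h1 : ∀ t : Word q n, ∑ c : ι → Word q n, f (c i - c l) =
      ∑ c : ι → Word q n, f (c i + t - c l) := by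
    intro t
    rw [← Equiv.sum_comp (Equiv.addRight (Pi.single i t : ι → Word q n))]
    refine Finset.sum_congr rfl fun c _ => ?_
    simp [Pi.single_eq_of_ne h.symm]
  have h2 : ∀ c : ι → Word q n, ∑ t, f (c i + t - c l) = ∑ a, f a := by
    intro c
    rw [← Equiv.sum_comp (Equiv.addLeft (c i - c l)) f]
    refine Finset.sum_congr rfl fun t _ => ?_
    congr 1
    simp only [Equiv.coe_addLeft]
    abel
  calc (Fintype.card (Word q n) : ℝ) * ∑ c : ι → Word q n, f (c i - c l)
      = ∑ t : Word q n, ∑ c : ι → Word q n, f (c i + t - c l) := by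
        rw [← nsmul_eq_mul, ← Finset.card_univ, ← Finset.sum_const]
        exact Finset.sum_congr rfl fun t _ => h1 t
    _ = ∑ c : ι → Word q n, ∑ a, f a := by
        rw [Finset.sum_comm]
        exact Finset.sum_congr rfl fun c _ => h2 c
    _ = _ := by rw [Finset.sum_const, nsmul_eq_mul, Finset.card_univ]

theorem sum_sub_eq {ι : Type*} [Fintype ι] [DecidableEq ι] {i l : ι} (h : i ≠ l)
    (f : Word q n → ℝ) :
    ∑ c : ι → Word q n, f (c i - c l) =
      Fintype.card (ι → Word q n) * ((∑ a, f a) / Fintype.card (Word q n)) := by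
  have hN : (Fintype.card (Word q n) : ℝ) ≠ 0 := Nat.cast_ne_zero.2 Fintype.card_ne_zero
  rw [← mul_div_assoc, ← card_mul_sum_sub h]
  field_simp

/-- Random codes of small rate have a large minimum distance. -/
theorem le_codeProb_hasMinDist (m d : ℕ) :
    1 - ENNReal.ofReal ((m : ℝ) ^ 2 * (ballVolume q n (d - 1) / Fintype.card (Word q n))) ≤
      codeProb q n m {c | HasMinDist (codewords c).toFinset d} := by
  let f : Word q n → ℝ := fun a => if hammingNorm a ≤ d - 1 then 1 else 0
  have hf : ∀ a, 0 ≤ f a := fun a => by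
    simp only [f]
    split_ifs <;> norm_num
  have hfsum : ∑ a, f a = ballVolume q n (d - 1) := by
    simp only [f]
    rw [Finset.sum_boole, card_filter_hammingNorm_le]
  -- The number of ordered pairs of positions whose words differ by a word of weight at most `d -
  -- 1`.
  refine le_codeProb (X := fun c => ∑ i, ∑ l ∈ Finset.univ.erase i, f (c i - c l))
    (fun c => Finset.sum_nonneg fun i _ => Finset.sum_nonneg fun l _ => hf _)
    (fun c hc => ?_) ?_
  · simp only [Set.mem_ofPred_eq, HasMinDist, not_forall] at hc
    obtain ⟨a, ha, b, hb, hab, hlt⟩ := hc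
    simp only [codewords, List.mem_toFinset, List.mem_dedup, List.mem_ofFn] at ha hb
    obtain ⟨i, rfl⟩ := ha
    obtain ⟨l, rfl⟩ := hb
    have h1 : f (c i - c l) = 1 := by
      simp only [f]
      rw [if_pos]
      rw [← hammingNorm_neg, neg_sub, sub_eq_neg_add, ← hammingDist_eq_hammingNorm]
      omega
    have hl : l ∈ Finset.univ.erase i :=
      Finset.mem_erase.2 ⟨fun h => hab (by rw [h]), Finset.mem_univ _⟩
    calc (1 : ℝ) = f (c i - c l) := h1.symm
      _ ≤ ∑ l ∈ Finset.univ.erase i, f (c i - c l) :=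
          Finset.single_le_sum (f := fun l => f (c i - c l)) (fun l _ => hf _) hl
      _ ≤ _ := Finset.single_le_sum (f := fun i => ∑ l ∈ Finset.univ.erase i, f (c i - c l))
          (fun i _ => Finset.sum_nonneg fun l _ => hf _) (Finset.mem_univ i)
  · rw [Finset.sum_comm]
    have h1 : ∀ i : Fin m, ∑ c : Fin m → Word q n, ∑ l ∈ Finset.univ.erase i, f (c i - c l) ≤
        m * (Fintype.card (Fin m → Word q n) *
          (ballVolume q n (d - 1) / Fintype.card (Word q n))) := by
      intro i
      rw [Finset.sum_comm, Finset.sum_congr rfl fun l hl =>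
        sum_sub_eq (Finset.ne_of_mem_erase hl).symm f, Finset.sum_const, hfsum, nsmul_eq_mul]
      refine mul_le_mul_of_nonneg_right ?_ (by positivity)
      exact_mod_cast Finset.card_erase_le.trans_eq (by simp)
    refine (Finset.sum_le_sum fun i _ => h1 i).trans_eq ?_
    rw [Finset.sum_const, Finset.card_univ, Fintype.card_fin, nsmul_eq_mul]
    ring

/-! ### Blocks of random words -/

/-- The words of the block `j` that do not occur in later blocks. -/
def freshWords {s : ℕ} (β : Fin s → Finset (Word q n)) (j : Fin s) : Finset (Word q n) :=
  (β j).filter fun c => ∀ i, j < i → c ∉ β i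

/-- The set can serve as a block of columns for the algorithm. -/
def IsGoodBlock (dZ : ℕ) (S : Finset (Word q n)) : Prop :=
  Balanced dZ S ∧ blockSize q n dZ ≤ S.card

open Classical in
-- `List.dedup` keeps last occurrences. Hence what remains of a block is a run of consecutive words,
-- namely those absent from all later blocks, and later blocks do not notice earlier ones.
theorem hasBlocks_dedup_flatten (dZ : ℕ) {s : ℕ} (β : Fin s → List (Word q n)) :
    HasBlocks dZ (Finset.univ.filter fun j =>
      IsGoodBlock dZ (freshWords (fun i => (β i).toFinset) j)).card
      (List.ofFn β).flatten.dedup := by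
  induction s with
  | zero => simpa using HasBlocks.zero _
  | succ s ih =>
    have hih := ih fun j => β j.succ
    set l := (List.ofFn fun j => β j.succ).flatten.dedup with hl
    have hded : (List.ofFn β).flatten.dedup = β 0 ∪ l := by
      rw [List.ofFn_succ, List.flatten_cons, List.dedup_append]
    have hnd : (β 0 ∪ l).Nodup := hded ▸ List.nodup_dedup _
    obtain ⟨b, hb⟩ := List.suffix_union_right (β 0) l
    rw [← hb, List.nodup_append'] at hnd
    have hsucc : ∀ j : Fin s, freshWords (fun i => (β i).toFinset) j.succ =
        freshWords (fun i => (β i.succ).toFinset) j := by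
      intro j
      ext c
      simp [freshWords, Fin.forall_fin_succ]
    have hzero : freshWords (fun i => (β i).toFinset) 0 = b.toFinset := by
      ext c
      have h1 : c ∈ b ++ l ↔ c ∈ β 0 ∨ c ∈ l := by rw [hb, List.mem_union_iff]
      have h2 : c ∈ l ↔ ∃ j : Fin s, c ∈ β j.succ := by
        simp [hl, List.mem_ofFn]
      have h3 : c ∈ b → c ∉ l := fun h h' => hnd.2.2 h h'
      simp only [freshWords, Finset.mem_filter, List.mem_toFinset, Fin.forall_fin_succ,
        lt_irrefl, Fin.succ_pos, false_imp_iff, true_imp_iff, true_and]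
      rw [← not_exists, ← h2]
      rw [List.mem_append] at h1
      tauto
    rw [Fin.card_filter_univ_succ, hded, ← hb]
    simp only [hsucc, hzero]
    split_ifs with hgood
    · simpa using HasBlocks.succ _ [] b l hgood.1 hgood.2 hih
    · exact hih.append_left b

section Blocks

variable {m s k : ℕ} (e : Fin s × Fin k → Fin m)

/-- The words drawn in the positions of the block `j`. -/
def drawnBlock (c : Fin m → Word q n) (j : Fin s) : Finset (Word q n) :=
  Finset.univ.image fun i => c (e (j, i))

/-- Freshness depends only on which draws coincide, so it commutes with renaming words. This allows
averaging over permutations although collisions are present. -/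
theorem freshWords_perm {q n : ℕ} (π : Equiv.Perm (Word q n)) (c : Fin m → Word q n) (j : Fin s) :
    freshWords (drawnBlock e (π ∘ c)) j =
      (freshWords (drawnBlock e c) j).map π.toEmbedding := by
  have h : ∀ i w, w ∈ drawnBlock e (π ∘ c) i ↔ π.symm w ∈ drawnBlock e c i := by
    intro i w
    simp [drawnBlock, Equiv.eq_symm_apply]
  ext w
  rw [Finset.mem_map_equiv]
  simp [freshWords, h]

variable (dZ : ℕ)

/-- Large sets of fresh words have small discrepancy on average. -/
theorem sum_discrepancy_freshWords_le (hk : 0 < k) (j : Fin s) :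
    ∑ c : Fin m → Word q n, (if k ≤ 2 * (freshWords (drawnBlock e c) j).card then
        2 * discrepancy dZ (freshWords (drawnBlock e c) j) /
          ((freshWords (drawnBlock e c) j).card : ℝ) ^ 2 else 0) ≤
      Fintype.card (Fin m → Word q n) * (8 * (ballVolume q n (dZ - 1) : ℝ) ^ 2 / k) := by
  set H : (Fin m → Word q n) → ℝ := fun c =>
    if k ≤ 2 * (freshWords (drawnBlock e c) j).card then
      2 * discrepancy dZ (freshWords (drawnBlock e c) j) /
        ((freshWords (drawnBlock e c) j).card : ℝ) ^ 2 else 0 with hH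
  set V : ℝ := (ballVolume q n (dZ - 1) : ℝ)
  have hk' : (0 : ℝ) < k := Nat.cast_pos.2 hk
  have hP : (0 : ℝ) < Fintype.card (Equiv.Perm (Word q n)) := Nat.cast_pos.2 Fintype.card_pos
  -- Renaming the words preserves the uniform distribution of codes.
  have h1 : ∀ π : Equiv.Perm (Word q n), ∑ c, H c = ∑ c, H (π ∘ c) := fun π =>
    (Equiv.sum_comp (Equiv.arrowCongr (Equiv.refl (Fin m)) π) H).symm
  have h2 : ∀ c, ∑ π : Equiv.Perm (Word q n), H (π ∘ c) ≤
      Fintype.card (Equiv.Perm (Word q n)) * (8 * V ^ 2 / k) := by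
    intro c
    simp only [hH, freshWords_perm, Finset.card_map]
    set σ := (freshWords (drawnBlock e c) j).card with hσ
    split_ifs with h
    -- The average is at most `2 * 2 V² σ / σ² = 4 V² / σ`, and `k ≤ 2 σ` turns this into `8 V² /
    -- k`.
    · have hσk : (k : ℝ) ≤ 2 * σ := by exact_mod_cast h
      have hσ0 : (0 : ℝ) < σ := by linarith
      rw [← Finset.sum_div, ← Finset.mul_sum, div_le_iff₀ (by positivity)]
      calc 2 * ∑ π : Equiv.Perm (Word q n),
            discrepancy dZ ((freshWords (drawnBlock e c) j).map π.toEmbedding)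
          ≤ 2 * (Fintype.card (Equiv.Perm (Word q n)) * (2 * V ^ 2 * σ)) :=
            mul_le_mul_of_nonneg_left (sum_perm_discrepancy_le _) zero_le_two
        _ = Fintype.card (Equiv.Perm (Word q n)) * (4 * V ^ 2 / k) * (k * σ) := by
            field_simp
            ring
        _ ≤ Fintype.card (Equiv.Perm (Word q n)) * (4 * V ^ 2 / k) * (2 * σ * σ) := by
            gcongr
        _ = _ := by ring
    · rw [Finset.sum_const_zero]
      positivity
  refine le_of_mul_le_mul_left ?_ hP
  calc (Fintype.card (Equiv.Perm (Word q n)) : ℝ) * ∑ c, H c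
      = ∑ π : Equiv.Perm (Word q n), ∑ c, H (π ∘ c) := by
        rw [← nsmul_eq_mul, ← Finset.card_univ, ← Finset.sum_const]
        exact Finset.sum_congr rfl fun π _ => h1 π
    _ = ∑ c, ∑ π : Equiv.Perm (Word q n), H (π ∘ c) := Finset.sum_comm
    _ ≤ ∑ c : Fin m → Word q n, Fintype.card (Equiv.Perm (Word q n)) * (8 * V ^ 2 / k) :=
        Finset.sum_le_sum fun c _ => h2 c
    _ = _ := by
        rw [Finset.sum_const, nsmul_eq_mul, Finset.card_univ]
        ring

/-- Few of the words of a block are lost to collisions. -/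
theorem sub_card_freshWords_le {q n : ℕ} (c : Fin m → Word q n) (j : Fin s) :
    (k : ℝ) - (freshWords (drawnBlock e c) j).card ≤
      ∑ i : Fin k, ∑ p ∈ Finset.univ.erase (j, i),
        if c (e (j, i)) - c (e p) = 0 then (1 : ℝ) else 0 := by
  classical
  -- Positions of the block whose word is drawn nowhere else among the blocks.
  set G : Finset (Fin k) := Finset.univ.filter fun i =>
    ∀ p, p ≠ (j, i) → c (e (j, i)) - c (e p) ≠ 0 with hG
  have hmaps : (G.image fun i => c (e (j, i))) ⊆ freshWords (drawnBlock e c) j := by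
    intro w hw
    obtain ⟨i, hi, rfl⟩ := Finset.mem_image.1 hw
    have hi' := (Finset.mem_filter.1 hi).2
    refine Finset.mem_filter.2 ⟨Finset.mem_image_of_mem _ (Finset.mem_univ i), fun l hl h => ?_⟩
    obtain ⟨i', -, hi'⟩ := Finset.mem_image.1 h
    exact (Finset.mem_filter.1 hi).2 (l, i') (fun h => hl.ne' (Prod.ext_iff.1 h).1)
      (sub_eq_zero.2 hi'.symm)
  have hinj : Set.InjOn (fun i => c (e (j, i))) G := by
    intro i hi i' _ h
    by_contra hne
    exact (Finset.mem_filter.1 hi).2 (j, i') (fun h => hne (Prod.ext_iff.1 h).2.symm)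
      (sub_eq_zero.2 h)
  have hcard : G.card ≤ (freshWords (drawnBlock e c) j).card := by
    rw [← Finset.card_image_of_injOn hinj]
    exact Finset.card_le_card hmaps
  have hterm : ∀ i : Fin k, (1 : ℝ) ≤ (if i ∈ G then 1 else 0) +
      ∑ p ∈ Finset.univ.erase (j, i),
        if c (e (j, i)) - c (e p) = 0 then (1 : ℝ) else 0 := by
    intro i
    by_cases hi : i ∈ G
    · rw [if_pos hi, le_add_iff_nonneg_right]
      exact Finset.sum_nonneg fun p _ => by split_ifs <;> norm_num
    · rw [if_neg hi, zero_add]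
      simp only [hG, Finset.mem_filter, Finset.mem_univ, true_and, not_forall, not_not] at hi
      obtain ⟨p, hp, h⟩ := hi
      refine le_trans (by rw [if_pos h]) (Finset.single_le_sum
        (f := fun p => if c (e (j, i)) - c (e p) = 0 then (1 : ℝ) else 0)
        (fun p _ => by split_ifs <;> norm_num)
        (Finset.mem_erase.2 ⟨hp, Finset.mem_univ p⟩))
  have hsum := Finset.sum_le_sum fun i (_ : i ∈ Finset.univ) => hterm i
  rw [Finset.sum_add_distrib, Finset.sum_boole] at hsum
  simp only [Finset.sum_const, Finset.card_univ, Fintype.card_fin, nsmul_eq_mul, mul_one,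
    Finset.filter_univ_mem] at hsum
  have : (G.card : ℝ) ≤ (freshWords (drawnBlock e c) j).card := by exact_mod_cast hcard
  linarith

/-- If fewer than half of the words are fresh, there are more than `k / 2` collisions with positions
of the block. Each of the at most `k * (s * k)` pairs collides with probability one over the number
of words. -/
theorem sum_card_freshWords_small_le (he : Function.Injective e) (hk : 0 < k) (j : Fin s) :
    ∑ c : Fin m → Word q n,
        (if k ≤ 2 * (freshWords (drawnBlock e c) j).card then (0 : ℝ) else 1) ≤
      Fintype.card (Fin m → Word q n) * (2 * (s * k) / Fintype.card (Word q n)) := by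
  have hk' : (0 : ℝ) < k := Nat.cast_pos.2 hk
  let f : Word q n → ℝ := fun a => if a = 0 then 1 else 0
  have hf : ∀ a, 0 ≤ f a := fun a => by
    simp only [f]
    split_ifs <;> norm_num
  have h1 : ∀ c : Fin m → Word q n,
      (if k ≤ 2 * (freshWords (drawnBlock e c) j).card then (0 : ℝ) else 1) ≤
        2 / k * ∑ i : Fin k, ∑ p ∈ Finset.univ.erase (j, i), f (c (e (j, i)) - c (e p)) := by
    intro c
    split_ifs with h
    · exact mul_nonneg (by positivity)
        (Finset.sum_nonneg fun i _ => Finset.sum_nonneg fun p _ => hf _)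
    · have h2 := sub_card_freshWords_le e c j
      have h3 : 2 * ((freshWords (drawnBlock e c) j).card : ℝ) < k := by
        exact_mod_cast not_le.1 h
      rw [div_mul_eq_mul_div, le_div_iff₀ hk']
      simp only [f]
      linarith
  refine (Finset.sum_le_sum fun c _ => h1 c).trans ?_
  rw [← Finset.mul_sum, Finset.sum_comm]
  have h2 : ∀ i : Fin k, ∑ c : Fin m → Word q n, ∑ p ∈ Finset.univ.erase (j, i),
      f (c (e (j, i)) - c (e p)) ≤
        (s * k) * (Fintype.card (Fin m → Word q n) * (1 / Fintype.card (Word q n))) := by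
    intro i
    have hfs : ∑ a, f a = 1 := by simp [f]
    rw [Finset.sum_comm, Finset.sum_congr rfl fun p hp =>
      sum_sub_eq (fun h => Finset.ne_of_mem_erase hp (he h).symm) f, Finset.sum_const,
      nsmul_eq_mul, hfs]
    refine mul_le_mul_of_nonneg_right ?_ (by positivity)
    exact_mod_cast Finset.card_erase_le.trans_eq (by simp)
  refine (mul_le_mul_of_nonneg_left (Finset.sum_le_sum fun i _ => h2 i) (by positivity)).trans_eq
    ?_
  rw [Finset.sum_const, Finset.card_univ, Fintype.card_fin, nsmul_eq_mul]
  field_simp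

open Classical in
/-- Most blocks of random words are good. -/
theorem le_codeProb_card_isGoodBlock (he : Function.Injective e) (hs : 0 < s) (hk : 0 < k)
    (hkV : 4 * ballVolume q n (dZ - 1) ≤ k) :
    1 - ENNReal.ofReal (2 * (8 * (ballVolume q n (dZ - 1) : ℝ) ^ 2 / k +
        2 * (s * k) / Fintype.card (Word q n))) ≤
      codeProb q n m {c | s ≤ 2 * (Finset.univ.filter fun j =>
        IsGoodBlock dZ (freshWords (drawnBlock e c) j)).card} := by
  have hs' : (0 : ℝ) < s := Nat.cast_pos.2 hs
  -- An upper bound for the indicator of a bad block: it has too few fresh words, or they have large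
  -- discrepancy.
  let Y : (Fin m → Word q n) → Fin s → ℝ := fun c j =>
    (if k ≤ 2 * (freshWords (drawnBlock e c) j).card then
      2 * discrepancy dZ (freshWords (drawnBlock e c) j) /
        ((freshWords (drawnBlock e c) j).card : ℝ) ^ 2 else 0) +
    (if k ≤ 2 * (freshWords (drawnBlock e c) j).card then 0 else 1)
  have hdisc : ∀ S : Finset (Word q n), 0 ≤ discrepancy dZ S := fun S => by
    unfold discrepancy
    positivity
  have hY0 : ∀ c j, 0 ≤ Y c j := fun c j => by
    simp only [Y]
    split_ifs
    · have := hdisc (freshWords (drawnBlock e c) j)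
      positivity
    · norm_num
  have hY1 : ∀ c j, ¬ IsGoodBlock dZ (freshWords (drawnBlock e c) j) → 1 ≤ Y c j := by
    intro c j h
    simp only [Y]
    split_ifs with hσ
    · have hσ0 : (0 : ℝ) < (freshWords (drawnBlock e c) j).card := by
        exact_mod_cast (by omega : 0 < (freshWords (drawnBlock e c) j).card)
      rw [add_zero, le_div_iff₀ (by positivity), one_mul]
      by_contra! hlt
      refine h ⟨balanced_of_discrepancy_lt hlt, ?_⟩
      -- Here `4 V ≤ k` and `k ≤ 2 σ` give `2 V ≤ σ`.
      rw [blockSize]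
      omega
    · norm_num
  -- On failure at least half of the `s` blocks are bad, whence the factor `2 / s`.
  refine le_codeProb (X := fun c => 2 / s * ∑ j, Y c j)
    (fun c => mul_nonneg (by positivity) (Finset.sum_nonneg fun j _ => hY0 c j))
    (fun c hc => ?_) ?_
  · rw [Set.mem_ofPred_eq, not_le] at hc
    have h1 : ((Finset.univ.filter fun j =>
        ¬ IsGoodBlock dZ (freshWords (drawnBlock e c) j)).card : ℝ) ≤ ∑ j, Y c j := by
      rw [← Finset.sum_boole]
      refine Finset.sum_le_sum fun j _ => ?_
      split_ifs with h
      · exact hY0 c j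
      · exact hY1 c j h
    have h2 := Finset.card_filter_add_card_filter_not (s := (Finset.univ : Finset (Fin s)))
      fun j => IsGoodBlock dZ (freshWords (drawnBlock e c) j)
    rw [Finset.card_univ, Fintype.card_fin] at h2
    have h3 : (s : ℝ) ≤ 2 * (Finset.univ.filter fun j =>
        ¬ IsGoodBlock dZ (freshWords (drawnBlock e c) j)).card := by
      exact_mod_cast (by omega : s ≤ 2 * (Finset.univ.filter fun j =>
        ¬ IsGoodBlock dZ (freshWords (drawnBlock e c) j)).card)
    rw [div_mul_eq_mul_div, le_div_iff₀ hs']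
    linarith
  · rw [← Finset.mul_sum, Finset.sum_comm]
    have h1 : ∀ j, ∑ c, Y c j ≤ Fintype.card (Fin m → Word q n) *
        (8 * (ballVolume q n (dZ - 1) : ℝ) ^ 2 / k +
          2 * (s * k) / Fintype.card (Word q n)) := by
      intro j
      simp only [Y]
      rw [Finset.sum_add_distrib, mul_add]
      exact add_le_add (sum_discrepancy_freshWords_le e dZ hk j)
        (sum_card_freshWords_small_le e he hk j)
    refine (mul_le_mul_of_nonneg_left (Finset.sum_le_sum fun j _ => h1 j)
      (by positivity)).trans_eq ?_
    rw [Finset.sum_const, Finset.card_univ, Fintype.card_fin, nsmul_eq_mul]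
    field_simp

end Blocks

/-- At least half of the `s` blocks are good with the stated probability, and two of the good ones
pay for the kernel vector. -/
theorem le_codeProb_algorithmBuilds (dZ : ℕ) {m s k : ℕ} (hs : 4 ≤ s) (hk : 0 < k)
    (hkV : 4 * ballVolume q n (dZ - 1) ≤ k) (hm : s * k ≤ m) :
    1 - ENNReal.ofReal (2 * (8 * (ballVolume q n (dZ - 1) : ℝ) ^ 2 / k +
        2 * (s * k) / Fintype.card (Word q n))) ≤
      codeProb q n m {c | ∃ t : ℕ, s ≤ 2 * (t + 2) ∧ AlgorithmBuilds dZ (codewords c) t} := by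
  classical
  obtain ⟨p, rfl⟩ := Nat.exists_eq_add_of_le' hm
  -- The blocks fill the last `s * k` positions, because removing duplicates leaves the deduplicated
  -- tail as a suffix.
  let e : Fin s × Fin k → Fin (p + s * k) := fun x => Fin.natAdd p (finProdFinEquiv x)
  have he : Function.Injective e := (Fin.natAdd_injective _ _).comp finProdFinEquiv.injective
  refine (le_codeProb_card_isGoodBlock e dZ he (by omega) hk hkV).trans
    (MeasureTheory.OuterMeasure.mono _ fun c hc => ?_)
  rw [Set.mem_ofPred_eq] at hc
  set g := (Finset.univ.filter fun j =>
    IsGoodBlock dZ (freshWords (drawnBlock e c) j)).card with hg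
  have hblocks : HasBlocks dZ g (codewords c) := by
    let β : Fin s → List (Word q n) := fun j => List.ofFn fun i => c (e (j, i))
    have hβ : (fun j => (β j).toFinset) = drawnBlock e c := by
      funext j
      ext w
      simp [β, drawnBlock, List.mem_ofFn]
    have h1 := hasBlocks_dedup_flatten dZ β
    rw [hβ] at h1
    refine h1.of_suffix ?_
    rw [codewords, List.ofFn_add, List.ofFn_mul, List.dedup_append]
    convert List.suffix_union_right _ _ using 5
    refine funext fun j => congrArg List.ofFn (funext fun i => ?_)
    simp only [e]
    congr 2
    ext
    simp only [finProdFinEquiv_apply_val]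
    ring
  -- Since `4 ≤ s`, at least two blocks are good and the subtraction is not truncated.
  exact ⟨g - 2, by omega, algorithmBuilds_of_hasBlocks (List.nodup_dedup _)
    (hblocks.of_le (by omega))⟩

end Random

/-! ### The volume of Hamming balls -/

theorem rpow_entropy_mul {q : ℕ} (hq : 2 ≤ q) (δ x : ℝ) :
    (q : ℝ) ^ (entropy q δ * x) = Real.exp (Real.qaryEntropy q δ * x) := by
  have hq1 : (1 : ℝ) < q := by exact_mod_cast hq
  have hlog : Real.log q ≠ 0 := (Real.log_pos hq1).ne'
  rw [Real.rpow_def_of_pos (by linarith), entropy]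
  congr 1
  field_simp

/-- An exponential moment bound: for `0 < lam ≤ 1` and `w ≤ δ n` one has `lam ^ (δ n) ≤ lam ^ w`,
and the binomial theorem sums the weighted terms to at most `(1 + (q - 1) lam) ^ n`. -/
theorem ballVolume_le {q n d : ℕ} (hq : 2 ≤ q) {δ : ℝ} (h0 : 0 ≤ δ) (h1 : δ ≤ 1 - 1 / q)
    (hd : (d : ℝ) ≤ δ * n) : (ballVolume q n d : ℝ) ≤ (q : ℝ) ^ (entropy q δ * n) := by
  have hq1 : (1 : ℝ) < q := by exact_mod_cast hq
  have hqi : (0 : ℝ) < 1 / q := by positivity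
  rcases h0.eq_or_lt with rfl | hδ
  · have : d = 0 := by
      rw [zero_mul] at hd
      exact_mod_cast le_antisymm hd (Nat.cast_nonneg d)
    subst this
    simp [ballVolume, entropy]
  have hδ1 : 0 < 1 - δ := by linarith
  have hqs : (0 : ℝ) < q - 1 := by linarith
  -- This choice makes the base `1 / (1 - δ)` and produces the entropy; `lam ≤ 1` is equivalent to
  -- `δ ≤ 1 - 1 / q`.
  set lam : ℝ := δ / ((1 - δ) * (q - 1)) with hlam
  have hlam0 : 0 < lam := by positivity
  have hlam1 : lam ≤ 1 := by
    rw [hlam, div_le_one (by positivity)]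
    have h2 : δ * q ≤ q - 1 := by
      calc δ * q ≤ (1 - 1 / q) * q := mul_le_mul_of_nonneg_right h1 (by linarith)
        _ = q - 1 := by field_simp
    nlinarith
  have hdn : d ≤ n := by
    have : (d : ℝ) ≤ n := hd.trans (mul_le_of_le_one_left (Nat.cast_nonneg n) (by linarith))
    exact_mod_cast this
  have hsum : (ballVolume q n d : ℝ) * lam ^ (δ * n) ≤ (1 / (1 - δ)) ^ n := by
    have h2 : ((q - 1 : ℝ) * lam + 1) = 1 / (1 - δ) := by
      rw [hlam]
      field_simp
      ring
    rw [← h2, add_pow, ballVolume, Nat.cast_sum, Finset.sum_mul]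
    calc ∑ w ∈ Finset.range (d + 1), ((n.choose w * (q - 1) ^ w : ℕ) : ℝ) * lam ^ (δ * n)
        ≤ ∑ w ∈ Finset.range (d + 1), ((q - 1 : ℝ) * lam) ^ w * 1 ^ (n - w) * n.choose w := by
          refine Finset.sum_le_sum fun w hw => ?_
          have hwd : (w : ℝ) ≤ δ * n := le_trans
            (by exact_mod_cast Nat.lt_succ_iff.1 (Finset.mem_range.1 hw)) hd
          have h3 : lam ^ (δ * n) ≤ lam ^ w := by
            rw [← Real.rpow_natCast]
            exact Real.rpow_le_rpow_of_exponent_ge hlam0 hlam1 hwd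
          calc ((n.choose w * (q - 1) ^ w : ℕ) : ℝ) * lam ^ (δ * n)
              ≤ ((n.choose w * (q - 1) ^ w : ℕ) : ℝ) * lam ^ w :=
                mul_le_mul_of_nonneg_left h3 (Nat.cast_nonneg _)
            _ = _ := by
                rw [one_pow, mul_one, mul_pow]
                push_cast [Nat.cast_sub (by omega : 1 ≤ q)]
                ring
      _ ≤ _ := Finset.sum_le_sum_of_subset_of_nonneg
          (Finset.range_mono (by omega)) fun w _ _ => by positivity
  have hpos : 0 < lam ^ (δ * n) := Real.rpow_pos_of_pos hlam0 _
  rw [← le_div_iff₀ hpos] at hsum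
  refine hsum.trans_eq ?_
  rw [rpow_entropy_mul hq, Real.rpow_def_of_pos hlam0, ← Real.rpow_natCast,
    Real.rpow_def_of_pos (by positivity), ← Real.exp_sub]
  congr 1
  rw [hlam, Real.log_div one_ne_zero hδ1.ne', Real.log_one,
    Real.log_div hδ.ne' (by positivity), Real.log_mul hδ1.ne' hqs.ne', Real.qaryEntropy,
    Real.binEntropy, Real.log_inv, Real.log_inv]
  push_cast
  ring

/-! ### Asymptotics -/

section Asymptotics

variable {q : ℕ} [NeZero q]

theorem codeProb_le_one (n m : ℕ) (E : Set (Fin m → Word q n)) : codeProb q n m E ≤ 1 := by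
  rw [codeProb]
  calc _ ≤ (PMF.uniformOfFintype (Fin m → Word q n)).toOuterMeasure Set.univ :=
        MeasureTheory.OuterMeasure.mono _ (Set.subset_univ _)
    _ = 1 := (PMF.toOuterMeasure_apply_eq_one_iff _ _).2 (Set.subset_univ _)

theorem tendsto_codeProb_one {m : ℕ → ℕ} {E : ∀ n, Set (Fin (m n) → Word q n)} {ε : ℕ → ℝ}
    (hε : Tendsto ε atTop (𝓝 0))
    (h : ∀ᶠ n in atTop, 1 - ENNReal.ofReal (ε n) ≤ codeProb q n (m n) (E n)) :
    Tendsto (fun n => codeProb q n (m n) (E n)) atTop (𝓝 1) := by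
  refine tendsto_of_tendsto_of_tendsto_of_le_of_le' (g := fun n => 1 - ENNReal.ofReal (ε n)) ?_
    tendsto_const_nhds h (Eventually.of_forall fun n => codeProb_le_one n _ _)
  have h1 := ENNReal.tendsto_ofReal hε
  rw [ENNReal.ofReal_zero] at h1
  simpa using ENNReal.Tendsto.sub (tendsto_const_nhds (x := (1 : ENNReal))) h1
    (Or.inl ENNReal.one_ne_top)

theorem codeSize_le {q n : ℕ} (hq : 2 ≤ q) {R : ℝ} (hR : 0 < R) :
    (codeSize q n R : ℝ) ≤ 2 * (q : ℝ) ^ (R * n) := by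
  have hq1 : (1 : ℝ) ≤ q := by exact_mod_cast (by omega : 1 ≤ q)
  have h1 : (1 : ℝ) ≤ (q : ℝ) ^ (R * n) := Real.one_le_rpow hq1 (by positivity)
  have := (Nat.ceil_lt_add_one (by linarith : 0 ≤ (q : ℝ) ^ (R * n))).le
  rw [codeSize]
  linarith

theorem card_word (n : ℕ) : (Fintype.card (Word q n) : ℝ) = (q : ℝ) ^ (n : ℝ) := by
  rw [Real.rpow_natCast]
  simp [ZMod.card]

/-- There are at most `4 q ^ (2 R n)` pairs of draws, each too close with probability at most `q ^
((Ent(δ) - 1) n)`. -/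
theorem tendsto_hasMinDist (hq : 2 ≤ q) {R δ : ℝ} (hR : 0 < R) (h0 : 0 ≤ δ) (h1 : δ ≤ 1 - 1 / q)
    (hRδ : 2 * R + entropy q δ < 1) :
    Tendsto (fun n : ℕ => codeProb q n (codeSize q n R)
      {c | HasMinDist (codewords c).toFinset ⌈δ * n⌉₊}) atTop (𝓝 1) := by
  have hq0 : (0 : ℝ) < q := by exact_mod_cast (by omega : 0 < q)
  have hq1 : (1 : ℝ) < q := by exact_mod_cast hq
  refine tendsto_codeProb_one (ε := fun n =>
    4 * ((q : ℝ) ^ (2 * R + entropy q δ - 1)) ^ n) ?_ (Eventually.of_forall fun n => ?_)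
  · have := (tendsto_pow_atTop_nhds_zero_of_lt_one (by positivity)
      (Real.rpow_lt_one_of_one_lt_of_neg hq1
        (by linarith : 2 * R + entropy q δ - 1 < 0))).const_mul 4
    simpa using this
  · refine le_trans (tsub_le_tsub_left (ENNReal.ofReal_le_ofReal ?_) 1)
      (le_codeProb_hasMinDist (codeSize q n R) ⌈δ * n⌉₊)
    have hV : (ballVolume q n (⌈δ * n⌉₊ - 1) : ℝ) ≤ (q : ℝ) ^ (entropy q δ * n) := by
      refine ballVolume_le hq h0 h1 ?_
      rcases Nat.eq_zero_or_pos ⌈δ * n⌉₊ with h | h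
      · simp only [h, zero_le, Nat.sub_eq_zero_of_le, Nat.cast_zero]
        positivity
      · rw [Nat.cast_sub h, Nat.cast_one]
        have := Nat.ceil_lt_add_one (by positivity : 0 ≤ δ * n)
        linarith
    have hm : (codeSize q n R : ℝ) ^ 2 ≤ (2 * (q : ℝ) ^ (R * n)) ^ 2 :=
      pow_le_pow_left₀ (Nat.cast_nonneg _) (codeSize_le hq hR) 2
    rw [card_word]
    calc _ ≤ (2 * (q : ℝ) ^ (R * n)) ^ 2 * ((q : ℝ) ^ (entropy q δ * n) / (q : ℝ) ^ (n : ℝ)) := by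
          gcongr
      _ = _ := by
          rw [mul_pow, ← Real.rpow_natCast _ n, ← Real.rpow_mul hq0.le, ← Real.rpow_sub hq0,
            sq ((q : ℝ) ^ (R * n)), mul_assoc, ← Real.rpow_add hq0, ← Real.rpow_add hq0]
          norm_num
          ring_nf

/-- Blocks of `n V²` draws make the discrepancy term of order `1 / n`. About `2 q ^ (r n)` of them
use at most a fraction `u n` of `q ^ (R n)`, which tends to `0` and, as `R ≤ 1`, bounds the
collision term as well. -/
theorem tendsto_algorithmBuilds (hq : 2 ≤ q) {R δ r : ℝ} {dZ : ℕ → ℕ} (hR : R ≤ 1) (h0 : 0 ≤ δ)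
    (h1 : δ ≤ 1 - 1 / q) (hdZ : ∀ᶠ n in atTop, 1 ≤ dZ n ∧ (dZ n : ℝ) ≤ δ * n + 1) (hr : 0 < r)
    (hrR : r < R - 2 * entropy q δ) :
    Tendsto (fun n : ℕ => codeProb q n (codeSize q n R)
      {c | ∃ t : ℕ, (q : ℝ) ^ (r * n) ≤ t + 2 ∧ AlgorithmBuilds (dZ n) (codewords c) t})
      atTop (𝓝 1) := by
  have hq0 : (0 : ℝ) < q := by exact_mod_cast (by omega : 0 < q)
  have hq1 : (1 : ℝ) < q := by exact_mod_cast hq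
  set η : ℝ := R - r - 2 * entropy q δ with hη
  set u : ℕ → ℝ := fun n => 6 * (n * ((q : ℝ) ^ (-η)) ^ n) with hu
  have hulim : Tendsto u atTop (𝓝 0) := by
    have := (tendsto_self_mul_const_pow_of_lt_one (by positivity)
      (Real.rpow_lt_one_of_one_lt_of_neg hq1 (by linarith : -η < 0))).const_mul 6
    simpa using this
  refine tendsto_codeProb_one (ε := fun n => 16 / n + 4 * u n) ?_ ?_
  · simpa using (tendsto_const_div_atTop_nhds_zero_nat 16).add (hulim.const_mul 4)
  filter_upwards [hdZ, eventually_ge_atTop 4, hulim.eventually_le_const zero_lt_one]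
    with n hd hn hun
  set V := ballVolume q n (dZ n - 1) with hV
  set k : ℕ := V ^ 2 * n with hk
  -- The factor `2` is there because only half of the blocks are sure to be good; the added `1`
  -- ensures `4 ≤ s`.
  set s : ℕ := 2 * (⌈(q : ℝ) ^ (r * n)⌉₊ + 1) with hs
  have hV0 : 0 < V := ballVolume_pos _ _ _
  have hn0 : (0 : ℝ) < n := by exact_mod_cast (by omega : 0 < n)
  have hk0 : 0 < k := by positivity
  have hrn : 1 ≤ (q : ℝ) ^ (r * n) := Real.one_le_rpow hq1.le (by positivity)
  have hs4 : 4 ≤ s := by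
    have : 0 < ⌈(q : ℝ) ^ (r * n)⌉₊ := Nat.ceil_pos.2 (by linarith)
    omega
  have hkV : 4 * V ≤ k := by
    calc 4 * V ≤ n * V := Nat.mul_le_mul_right _ hn
      _ ≤ n * (V * V) := Nat.mul_le_mul_left _ (Nat.le_mul_of_pos_left _ hV0)
      _ = k := by
        rw [hk]
        ring
  have hVle : (V : ℝ) ≤ (q : ℝ) ^ (entropy q δ * n) := by
    refine ballVolume_le hq h0 h1 ?_
    rw [Nat.cast_sub hd.1, Nat.cast_one]
    linarith [hd.2]
  have hsle : (s : ℝ) ≤ 6 * (q : ℝ) ^ (r * n) := by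
    have := (Nat.ceil_lt_add_one (by linarith : 0 ≤ (q : ℝ) ^ (r * n))).le
    rw [hs]
    push_cast
    linarith
  have hsk : (s : ℝ) * k ≤ (q : ℝ) ^ (R * n) * u n := by
    calc (s : ℝ) * k = s * ((V : ℝ) ^ 2 * n) := by rw [hk]; push_cast; rfl
      _ ≤ 6 * (q : ℝ) ^ (r * n) * (((q : ℝ) ^ (entropy q δ * n)) ^ 2 * n) := by gcongr
      _ = (q : ℝ) ^ (R * n) * u n := by
          have : (q : ℝ) ^ (R * n) = (q : ℝ) ^ (r * n) * ((q : ℝ) ^ (entropy q δ * n)) ^ 2 *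
              (q : ℝ) ^ (η * n) := by
            rw [sq, ← Real.rpow_add hq0, ← Real.rpow_add hq0, ← Real.rpow_add hq0, hη]
            ring_nf
          change _ = _ * (6 * (n * ((q : ℝ) ^ (-η)) ^ n))
          rw [this, ← Real.rpow_natCast _ n, ← Real.rpow_mul hq0.le, neg_mul,
            Real.rpow_neg hq0.le]
          have := (Real.rpow_pos_of_pos hq0 (η * n)).ne'
          field_simp
  have hm : s * k ≤ codeSize q n R := by
    have h2 : ((s * k : ℕ) : ℝ) ≤ (q : ℝ) ^ (R * n) := by
      push_cast
      exact hsk.trans (mul_le_of_le_one_right (by positivity) hun)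
    exact_mod_cast h2.trans (Nat.le_ceil _)
  refine (le_trans (tsub_le_tsub_left (ENNReal.ofReal_le_ofReal ?_) 1)
    (le_codeProb_algorithmBuilds (n := n) (dZ n) hs4 hk0 hkV hm)).trans
    (MeasureTheory.OuterMeasure.mono _ fun c hc => ?_)
  · have hsN : (s : ℝ) * k / Fintype.card (Word q n) ≤ u n := by
      have hu0 : 0 ≤ u n := by
        rw [hu]
        positivity
      rw [card_word, div_le_iff₀ (by positivity), mul_comm]
      rw [mul_comm (u n)]
      rw [mul_comm (k : ℝ)]
      refine hsk.trans (mul_le_mul_of_nonneg_right ?_ hu0)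
      exact Real.rpow_le_rpow_of_exponent_le hq1.le (mul_le_of_le_one_left hn0.le hR)
    have h8 : 8 * (V : ℝ) ^ 2 / k = 8 / n := by
      have : (V : ℝ) ≠ 0 := Nat.cast_ne_zero.2 hV0.ne'
      rw [hk]
      push_cast
      field_simp
    rw [← hV, h8, mul_div_assoc]
    have : (16 : ℝ) / n = 2 * (8 / n) := by ring
    rw [this]
    linarith
  · obtain ⟨t, ht, hb⟩ := hc
    refine ⟨t, ?_, hb⟩
    have h3 : ⌈(q : ℝ) ^ (r * n)⌉₊ ≤ t + 2 := by omega
    exact (Nat.le_ceil _).trans (by exact_mod_cast h3)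

end Asymptotics

end DinesCode

theorem mainTheorem7 (q : ℕ) [NeZero q] (hq : 2 ≤ q) :
    -- the recursion yields `B.length + 2` logical states as long as no obstruction is met
    (∀ (n dX dZ : ℕ) (C D : Finset (Word q n)) (x : Word q n → ℝ) (B : List (Finset (Word q n))),
      1 ≤ dX → 1 ≤ dZ → HasMinDist C dX →
      D ⊆ C → IsKernelVector dZ D x →
      (∀ S ∈ B, S ⊆ C ∧ Disjoint D S ∧ blockSize q n dZ ≤ S.card) → B.Pairwise Disjoint →
      RecursionUnobstructed dZ x⁻ B →
      (x⁺ :: x⁻ :: recursionPoints dZ x⁻ B).length = B.length + 2 ∧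
      IsQuantumCodeFrom C dX dZ (logicalStates (x⁺ :: x⁻ :: recursionPoints dZ x⁻ B))) ∧
    -- random codes: the algorithm succeeds with high probability, with constant rate
    (∀ (R δ r : ℝ) (dZ : ℕ → ℕ), 0 < R → R ≤ 1 → 0 ≤ δ → δ ≤ 1 - 1 / q →
      (∀ᶠ n in atTop, 1 ≤ dZ n ∧ (dZ n : ℝ) ≤ δ * n + 1) →
      0 < r → r < R - 2 * entropy q δ →
      Tendsto (fun n : ℕ => codeProb q n (codeSize q n R)
          {c | ∃ t : ℕ, (q : ℝ) ^ (r * n) ≤ t + 2 ∧ AlgorithmBuilds (dZ n) (codewords c) t})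
        atTop (𝓝 1)) ∧
    -- the bit-flip distance is linear for codes of small rate
    (∀ R δ : ℝ, 0 < R → 0 ≤ δ → δ ≤ 1 - 1 / q → 2 * R + entropy q δ < 1 →
      Tendsto (fun n : ℕ => codeProb q n (codeSize q n R)
          {c | HasMinDist (codewords c).toFinset ⌈δ * n⌉₊})
        atTop (𝓝 1)) := by
  refine ⟨fun n dX dZ C D x B hdX _ hC hDC hx hB hBd hun =>
    ⟨by simp [length_recursionPoints],
      isQuantumCodeFrom_recursion dZ hdX hC hDC hx hB hBd hun⟩, ?_, ?_⟩
  · intro R δ r dZ _ hR h0 h1 hdZ hr hrR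
    exact tendsto_algorithmBuilds hq hR h0 h1 hdZ hr hrR
  · intro R δ hR h0 h1 hRδ
    exact tendsto_hasMinDist hq hR h0 h1 hRδ
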